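/- **Setting.** Fix a set $V$ of values (used as data, data addresses and program points), a lattice of security labels with least (public) element $\bot$, a finite set of registers containing two distinct special ones, the stack pointer $r_{sp}$ and the temporary $r_{ret}$, and arbitrary functions giving the meaning of opcodes ($V^*\to V$), of branch conditions ($V^*\to\{\mathrm{true},\mathrm{false}\}$) and of address computation $\mathrm{addr}:V^*\to V$; two opcodes $succ$, $pred$ move the stack pointer. Values in registers and memory carry labels; the result of an operation carries the join of the labels of its operands. A program is a fixed partial map from program points to instructions: $op$, conditional branch, $load$, $store$, $fence$, indirect jump, $call$ and $ret$; operands are registers or labelled constants. No instruction of the program has $r_{ret}$ as an operand that it reads. A *configuration* $C=(\rho,\mu,n,buf)$ consists of a partial register map, a partial data memory, a program point and a reorder buffer, which is a partial map from $\mathbb N$ to transient instructions; it comes with a *return stack buffer* $\sigma$, a partial map from $\mathbb N$ to $\{\mathrm{push}\ m,\mathrm{pop}\}$, used only to predict return targets. $C$ is *initial* (equivalently, *terminal*) if $buf=\emptyset$. $C\approx C'$ means that $C$ and $C'$ have equal registers and equal memories, with labels; $C=C'$ means that all four components agree. In a buffer, an operand at index $i$ resolves to itself if it is a constant, and a register resolves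 to the value of its latest assignment at an index $<i$ (undefined if that assignment has no value yet), or to $\rho$ if there is no such assignment. A step is driven by one *directive*; it is possible only if the operands it uses resolve and the memory cells it reads are defined. Steps also emit observations (addresses read, written or forwarded, jump targets, rollbacks). * **Fetch** ($\mathsf{fetch}$, $\mathsf{fetch}:b$, $\mathsf{fetch}:m$). The transient form of the instruction at $n$ is put at $i=\max(\mathrm{dom}\,buf)+1$ (where $\max\emptyset=0$), and $n$ becomes the successor. For a branch the directive supplies the guessed outcome $b$, for an indirect jump the guessed target $m$; the guess is recorded in the entry. A call to $f$ with return point $p$ adds $\mathrm{call}$, $r_{sp}=succ(r_{sp})$ and $store(p,[r_{sp}])$ at $i,i+1,i+2$, sets $\sigma(i)=\mathrm{push}\ p$ and continues at $f$. A return adds $\mathrm{ret}$, $r_{ret}=load([r_{sp}])$, $r_{sp}=pred(r_{sp})$ and an indirect jump through $r_{ret}$ at $i,\dots,i+3$ and sets $\sigma(i)=\mathrm{pop}$; its guessed target is the top of the stack obtained by applying the entries of $\sigma$ in the order of their indices, or is supplied by the directive if that stack is empty. * **Execute** (always: no fence at an index $<i$). $\mathsf{execute}\ i$ evaluates an operation;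 or evaluates a branch or an indirect jump and replaces it by a resolved jump, where on a wrong guess all entries at indices $\ge i$ of $buf$ and of $\sigma$ are first deleted and $n$ becomes the correct target. For a load with address $a$, it takes the value from the latest store before $i$ whose address is resolved to $a$ (which must have a resolved value), recording the dependency on its index $j$, or from $\mu(a)$ with dependency $\bot$ if there is no such store. $\mathsf{execute}\ i:\mathsf{fwd}\ j$ gives an unresolved load at $i$ the resolved value $v$ of a store at $j<i$ before addresses are compared; a later $\mathsf{execute}\ i$ computes the address $a$ of the load. If the store is still at $j$, that step confirms the load if the store's address is unresolved or $a$ and no store strictly between $j$ and $i$ has resolved address $a$. If it has left the buffer, the step requires that no store before $i$ has resolved address $a$, and confirms the load (with dependency $\bot$) if $\mu(a)=v$ with label. Otherwise the step deletes all entries of $buf$ and $\sigma$ at indices $\ge i$ and sets $n$ to the program point of the load. $\mathsf{execute}\ i:\mathsf{value}$ and $\mathsf{execute}\ i:\mathsf{addr}$ resolve the value and the address $a$ of a store; if at some $k>i$ there is a resolved load with address $a_k$ and dependency $j_k$ such that $a_k=a$ and $j_k<i$ (where $\bot<i$), or $j_k=i$ and $a_k\ne a$, then for the least such $k$ all entries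 of $buf$ and $\sigma$ at indices $\ge k$ are deleted and $n$ becomes the program point of that load. * **Retire** ($\mathsf{retire}$). The entry with the least index, if fully resolved, is removed, and its effect is applied: an assignment to $\rho$, a store to $\mu$, none for a jump or a fence. The entries of a call, or of a return, are removed together; a call updates $r_{sp}$ and $\mu$, a return updates only $r_{sp}$. For a schedule (a finite list of directives) $D$, write $(C,\sigma)\Downarrow_D^N(C',\sigma')$ if executing $D$ takes $(C,\sigma)$ to $(C',\sigma')$ and $D$ contains exactly $N$ directives $\mathsf{retire}$; when this is possible, $D$ is *well-formed* for $C$. A *sequential execution* is an execution from an initial to a terminal configuration in which each fetch takes place when the reorder buffer is empty, that is, each fetched instruction is executed and retired before another one is fetched; write $\Downarrow^N_{seq}$ for sequential execution retiring $N$ instructions. **Theorem 1 (Equivalence to sequential execution).** Let $C$ be an initial configuration, with any return stack buffer $\sigma$, and let $D$ be a well-formed schedule with $(C,\sigma)\Downarrow_D^N(C_1,\sigma_1)$. Then there is a sequential execution $(C,\sigma)\Downarrow_{seq}^N(C_2,\sigma_2)$, and every such sequential execution satisfies $C_1\approx C_2$. Furthermore, if $C_1$ is terminal, then $C_1=C_2$.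 -/

import Mathlib

namespace Speculative

/-- Instruction operands: register names or labelled values (a value paired with its label). -/
inductive Operand (V L R : Type*) where
  | reg (r : R)
  | val (v : V × L)

/-- Physical instructions. `F` is the type of opcodes, `B` the type of branch conditions. -/
inductive Instr (V L R F B : Type*) where
  | op (f : F) (r : R) (args : List (Operand V L R)) (next : V)
  | br (b : B) (args : List (Operand V L R)) (nTrue nFalse : V)
  | load (r : R) (args : List (Operand V L R)) (next : V)
  | store (src : Operand V L R) (args : List (Operand V L R)) (next : V)
  | jmpi (args : List (Operand V L R))
  | call (target retPoint : V)
  | ret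
  | fence (next : V)

/-- The operands that occur in an instruction. -/
def Instr.operands {V L R F B : Type*} : Instr V L R F B → List (Operand V L R)
  | .op _ _ args _ => args
  | .br _ args _ _ => args
  | .load _ args _ => args
  | .store src args _ => src :: args
  | .jmpi args => args
  | .call _ _ => []
  | .ret => []
  | .fence _ => []

/-- The address part of a transient store: a list of operands until it is resolved, and then a
labelled address. -/
inductive StoreAddr (V L R : Type*) where
  | pending (args : List (Operand V L R))
  | resolved (a : V × L)

/-- Transient instructions. -/
inductive Trans (V L R F B : Type*) where
  /-- unresolved operation -/
  | op (f : F) (r : R) (args : List (Operand V L R))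
  /-- resolved operation `r = v` -/
  | val (r : R) (v : V × L)
  /-- unresolved conditional, predicted to go to `guess` -/
  | br (b : B) (args : List (Operand V L R)) (guess nTrue nFalse : V)
  /-- resolved jump -/
  | jump (n : V)
  /-- unresolved load, fetched at program point `pc` -/
  | load (r : R) (args : List (Operand V L R)) (pc : V)
  /-- partially resolved load, with the value `v` guessed to come from the store at index `j` -/
  | loadFwd (r : R) (args : List (Operand V L R)) (v : V × L) (j : ℕ) (pc : V)
  /-- resolved load `r = v {dep, a}`: address `a`, value from the store at index `dep`, or from
  memory if `dep = ⊥` -/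
  | loadVal (r : R) (v : V × L) (dep : WithBot ℕ) (a : V) (pc : V)
  /-- store; its source is resolved when it is a value -/
  | store (src : Operand V L R) (addr : StoreAddr V L R)
  /-- indirect jump, predicted to go to `guess` -/
  | jmpi (args : List (Operand V L R)) (guess : V)
  | call
  | ret
  | fence

/-- The transient form of the instructions that have a single successor (for the program point
`pc`), together with that successor. -/
def Instr.simple {V L R F B : Type*} (pc : V) :
    Instr V L R F B → Option (Trans V L R F B × V)
  | .op f r args next => some (.op f r args, next)
  | .load r args next => some (.load r args pc, next)
  | .store src args next => some (.store src (.pending args), next)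
  | .fence next => some (.fence, next)
  | _ => none

/-- The register that a transient instruction assigns. -/
def Trans.dest {V L R F B : Type*} : Trans V L R F B → Option R
  | .op _ r _ => some r
  | .val r _ => some r
  | .load r _ _ => some r
  | .loadFwd r _ _ _ _ => some r
  | .loadVal r _ _ _ _ => some r
  | _ => none

/-- The value that a transient instruction supplies to later instructions, if it has one. -/
def Trans.value {V L R F B : Type*} : Trans V L R F B → Option (V × L)
  | .val _ v => some v
  | .loadFwd _ _ v _ _ => some v
  | .loadVal _ v _ _ _ => some v
  | _ => none

/-- `t` is a fully resolved assignment `r = v`. -/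
inductive Trans.IsVal {V L R F B : Type*} (r : R) (v : V × L) : Trans V L R F B → Prop
  | val : Trans.IsVal r v (.val r v)
  | loadVal (dep : WithBot ℕ) (a pc : V) : Trans.IsVal r v (.loadVal r v dep a pc)

/-- `t` is a store whose address is resolved to `a`. -/
def Trans.StoresTo {V L R F B : Type*} (a : V) (t : Trans V L R F B) : Prop :=
  ∃ src l, t = .store src (.resolved (a, l))

/-- `t` is a resolved load that conflicts with the store at the earlier index `i` having address
`a`, and `pc` is its program point. -/
inductive Trans.Hazard {V L R F B : Type*} (i : ℕ) (a : V) (pc : V) : Trans V L R F B → Prop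
  | stale (r : R) (v : V × L) (dep : WithBot ℕ) : dep < (i : WithBot ℕ) →
      Trans.Hazard i a pc (.loadVal r v dep a pc)
  | misforward (r : R) (v : V × L) (a' : V) : a' ≠ a →
      Trans.Hazard i a pc (.loadVal r v (i : WithBot ℕ) a' pc)

/-- Reorder buffers: partial maps from indices to transient instructions. -/
abbrev Buf (V L R F B : Type*) := ℕ → Option (Trans V L R F B)

/-- Entries of the return stack buffer. -/
inductive RsbOp (V : Type*) where
  | push (n : V)
  | pop

/-- Return stack buffers. -/
abbrev Rsb (V : Type*) := ℕ → Option (RsbOp V)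

/-- The smallest index in the domain of a map (`0` if there is none). -/
noncomputable def minIdx {α : Type*} (m : ℕ → Option α) : ℕ := sInf {i | m i ≠ none}

/-- The largest index in the domain of a map (`0` if there is none). -/
noncomputable def maxIdx {α : Type*} (m : ℕ → Option α) : ℕ := sSup {i | m i ≠ none}

/-- The index of the next entry. -/
noncomputable def fresh {α : Type*} (m : ℕ → Option α) : ℕ := maxIdx m + 1

/-- `m[i ↦ x]` -/
def insert {α : Type*} (m : ℕ → Option α) (i : ℕ) (x : α) : ℕ → Option α :=
  Function.update m i (some x)

/-- `m` without index `i`. -/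
def erase {α : Type*} (m : ℕ → Option α) (i : ℕ) : ℕ → Option α :=
  Function.update m i none

/-- `m[j : j < i]` -/
def before {α : Type*} (m : ℕ → Option α) (i : ℕ) : ℕ → Option α :=
  fun j => if j < i then m j else none

/-- `m[j : j > i]` -/
def after {α : Type*} (m : ℕ → Option α) (i : ℕ) : ℕ → Option α :=
  fun j => if i < j then m j else none

/-- The effect of an entry of the return stack buffer on the stack of predicted return points
(its top is the head of the list). -/
def RsbOp.apply {V : Type*} (st : List V) : RsbOp V → List V
  | .push n => n :: st
  | .pop => st.tail

/-- The stack of predicted return points: all entries applied in the order of their indices. -/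
noncomputable def Rsb.stack {V : Type*} (σ : Rsb V) : List V :=
  ((List.range (maxIdx σ + 1)).filterMap σ).foldl RsbOp.apply []

/-- The predicted return point, if there is one. -/
noncomputable def Rsb.top {V : Type*} (σ : Rsb V) : Option V := σ.stack.head?

/-- Configurations: registers, data memory, current program point, reorder buffer. -/
structure Config (V L R F B : Type*) where
  reg : R → Option (V × L)
  mem : V → Option (V × L)
  pc : V
  buf : Buf V L R F B

/-- A configuration together with the return stack buffer. -/
structure State (V L R F B : Type*) where
  cfg : Config V L R F B
  rsb : Rsb V

/-- Initial (or terminal) configurations: the reorder buffer is empty. -/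
def Config.Terminal {V L R F B : Type*} (C : Config V L R F B) : Prop := ∀ i, C.buf i = none

/-- Equality of registers and memories. -/
def Config.Equiv {V L R F B : Type*} (C C' : Config V L R F B) : Prop :=
  C.reg = C'.reg ∧ C.mem = C'.mem

/-- What the semantics is parametric in: the meaning of opcodes, of branch conditions and of
address operands, the two opcodes that move the stack pointer, the stack pointer register and the
temporary register for return addresses. -/
structure Machine (V R F B : Type*) where
  evalOp : F → List V → V
  evalCond : B → List V → Bool
  addr : List V → V
  succ : F
  pred : F
  rsp : R
  rret : R
  rsp_ne_rret : rsp ≠ rret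

/-- Programs: partial maps from program points to instructions. -/
abbrev Program (V L R F B : Type*) := V → Option (Instr V L R F B)

/-- Attacker directives. -/
inductive Directive (V : Type*) where
  | fetch
  | fetchBranch (b : Bool)
  | fetchTarget (n : V)
  | execute (i : ℕ)
  | executeValue (i : ℕ)
  | executeAddr (i : ℕ)
  | executeFwd (i j : ℕ)
  | retire

/-- The three kinds of directives that fetch. -/
def Directive.IsFetch {V : Type*} : Directive V → Prop
  | .fetch => True
  | .fetchBranch _ => True
  | .fetchTarget _ => True
  | _ => False

/-- The number of `retire` directives in a schedule. -/
def numRetired {V : Type*} : List (Directive V) → ℕ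
  | [] => 0
  | .retire :: D => numRetired D + 1
  | _ :: D => numRetired D

/-- Observations. -/
inductive Obs (V L : Type*) where
  | read (a : V × L)
  | fwd (a : V × L)
  | write (a : V × L)
  | jump (n : V × L)
  | rollback

section Semantics

variable {V L R F B : Type*} [DecidableEq V] [DecidableEq R] [Lattice L] [OrderBot L]

/-- The register resolve function: the value of the latest assignment to `r` before index `i`
(undefined if it has no value yet), or that of the register map if there is no such assignment. -/
def resolveReg (buf : Buf V L R F B) (ρ : R → Option (V × L)) : ℕ → R → Option (V × L)
  | 0, r => ρ r
  | i + 1, r =>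
    match buf i with
    | none => resolveReg buf ρ i r
    | some t => if t.dest = some r then t.value else resolveReg buf ρ i r

/-- The register resolve function on operands. -/
def resolve (buf : Buf V L R F B) (ρ : R → Option (V × L)) (i : ℕ) :
    Operand V L R → Option (V × L)
  | .reg r => resolveReg buf ρ i r
  | .val v => some v

/-- The register resolve function on lists of operands. -/
def resolveAll (buf : Buf V L R F B) (ρ : R → Option (V × L)) (i : ℕ)
    (args : List (Operand V L R)) : Option (List (V × L)) :=
  args.mapM (resolve buf ρ i)

/-- The values in a list of labelled values. -/
def vals (vs : List (V × L)) : List V := vs.map Prod.fst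

/-- The join of the labels in a list of labelled values; the bottom label is the public one. -/
def lub (vs : List (V × L)) : L := (vs.map Prod.snd).foldr (· ⊔ ·) ⊥

/-- No fence before index `i`. -/
def NoFence (buf : Buf V L R F B) (i : ℕ) : Prop := ∀ j < i, buf j ≠ some .fence

/-- No store to address `a` at the indices `j` with `lo ≤ j < i`. -/
def NoStore (buf : Buf V L R F B) (a : V) (lo i : ℕ) : Prop :=
  ∀ j t, lo ≤ j → j < i → buf j = some t → ¬ t.StoresTo a

/-- The four entries that fetching a return adds at the index `i`. -/
def retEntries (M : Machine V R F B) (buf : Buf V L R F B) (i : ℕ) (pc guess : V) :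
    Buf V L R F B :=
  insert (insert (insert (insert buf i .ret)
    (i + 1) (.load M.rret [.reg M.rsp] pc))
    (i + 2) (.op M.pred M.rsp [.reg M.rsp]))
    (i + 3) (.jmpi [.reg M.rret] guess)

/-- The small-step semantics: `Step M P S d o S'` is the step from `S` to `S'` under the directive
`d` with the observations `o`. -/
inductive Step (M : Machine V R F B) (P : Program V L R F B) :
    State V L R F B → Directive V → List (Obs V L) → State V L R F B → Prop
  | simple_fetch {ρ μ n buf σ} {I t n'}
      (hI : P n = some I) (ht : I.simple n = some (t, n')) :
      Step M P ⟨⟨ρ, μ, n, buf⟩, σ⟩ .fetch []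
        ⟨⟨ρ, μ, n', insert buf (fresh buf) t⟩, σ⟩
  | cond_fetch {ρ μ n buf σ} {f args nt nf} (b : Bool)
      (hI : P n = some (.br f args nt nf)) :
      Step M P ⟨⟨ρ, μ, n, buf⟩, σ⟩ (.fetchBranch b) []
        ⟨⟨ρ, μ, cond b nt nf, insert buf (fresh buf) (.br f args (cond b nt nf) nt nf)⟩, σ⟩
  | jmpi_fetch {ρ μ n buf σ} {args} (n' : V)
      (hI : P n = some (.jmpi args)) :
      Step M P ⟨⟨ρ, μ, n, buf⟩, σ⟩ (.fetchTarget n') []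
        ⟨⟨ρ, μ, n', insert buf (fresh buf) (.jmpi args n')⟩, σ⟩
  | call_fetch {ρ μ n buf σ} {nf nr} {i : ℕ}
      (hI : P n = some (.call nf nr)) (hi : i = fresh buf) :
      Step M P ⟨⟨ρ, μ, n, buf⟩, σ⟩ .fetch []
        ⟨⟨ρ, μ, nf, insert (insert (insert buf i .call)
            (i + 1) (.op M.succ M.rsp [.reg M.rsp]))
            (i + 2) (.store (.val (nr, ⊥)) (.pending [.reg M.rsp]))⟩,
          insert σ i (.push nr)⟩
  | ret_fetch_rsb {ρ μ n buf σ} {n'} {i : ℕ}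
      (hI : P n = some .ret) (htop : Rsb.top σ = some n') (hi : i = fresh buf) :
      Step M P ⟨⟨ρ, μ, n, buf⟩, σ⟩ .fetch []
        ⟨⟨ρ, μ, n', retEntries M buf i n n'⟩, insert σ i .pop⟩
  | ret_fetch_rsb_empty {ρ μ n buf σ} (n' : V) {i : ℕ}
      (hI : P n = some .ret) (htop : Rsb.top σ = none) (hi : i = fresh buf) :
      Step M P ⟨⟨ρ, μ, n, buf⟩, σ⟩ (.fetchTarget n') []
        ⟨⟨ρ, μ, n', retEntries M buf i n n'⟩, insert σ i .pop⟩
  | op_execute {ρ μ n buf σ} {i f r args vs}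
      (hb : buf i = some (.op f r args)) (hf : NoFence buf i)
      (hv : resolveAll buf ρ i args = some vs) :
      Step M P ⟨⟨ρ, μ, n, buf⟩, σ⟩ (.execute i) []
        ⟨⟨ρ, μ, n, insert buf i (.val r (M.evalOp f (vals vs), lub vs))⟩, σ⟩
  | cond_execute_correct {ρ μ n buf σ} {i f args n₀ nt nf vs}
      (hb : buf i = some (.br f args n₀ nt nf)) (hf : NoFence buf i)
      (hv : resolveAll buf ρ i args = some vs)
      (hn : cond (M.evalCond f (vals vs)) nt nf = n₀) :
      Step M P ⟨⟨ρ, μ, n, buf⟩, σ⟩ (.execute i) [.jump (n₀, lub vs)]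
        ⟨⟨ρ, μ, n, insert buf i (.jump n₀)⟩, σ⟩
  | cond_execute_incorrect {ρ μ n buf σ} {i f args n₀ nt nf vs n'}
      (hb : buf i = some (.br f args n₀ nt nf)) (hf : NoFence buf i)
      (hv : resolveAll buf ρ i args = some vs)
      (hn : cond (M.evalCond f (vals vs)) nt nf = n') (hne : n' ≠ n₀) :
      Step M P ⟨⟨ρ, μ, n, buf⟩, σ⟩ (.execute i) [.rollback, .jump (n', lub vs)]
        ⟨⟨ρ, μ, n', insert (before buf i) i (.jump n')⟩, before σ i⟩
  | jmpi_execute_correct {ρ μ n buf σ} {i args n₀ vs}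
      (hb : buf i = some (.jmpi args n₀)) (hf : NoFence buf i)
      (hv : resolveAll buf ρ i args = some vs) (hn : M.addr (vals vs) = n₀) :
      Step M P ⟨⟨ρ, μ, n, buf⟩, σ⟩ (.execute i) [.jump (n₀, lub vs)]
        ⟨⟨ρ, μ, n, insert buf i (.jump n₀)⟩, σ⟩
  | jmpi_execute_incorrect {ρ μ n buf σ} {i args n₀ vs n'}
      (hb : buf i = some (.jmpi args n₀)) (hf : NoFence buf i)
      (hv : resolveAll buf ρ i args = some vs) (hn : M.addr (vals vs) = n') (hne : n' ≠ n₀) :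
      Step M P ⟨⟨ρ, μ, n, buf⟩, σ⟩ (.execute i) [.rollback, .jump (n', lub vs)]
        ⟨⟨ρ, μ, n', insert (before buf i) i (.jump n')⟩, before σ i⟩
  | load_execute_nodep {ρ μ n buf σ} {i r args pc vs a v}
      (hb : buf i = some (.load r args pc)) (hf : NoFence buf i)
      (hv : resolveAll buf ρ i args = some vs) (ha : M.addr (vals vs) = a)
      (hs : NoStore buf a 0 i) (hm : μ a = some v) :
      Step M P ⟨⟨ρ, μ, n, buf⟩, σ⟩ (.execute i) [.read (a, lub vs)]
        ⟨⟨ρ, μ, n, insert buf i (.loadVal r v ⊥ a pc)⟩, σ⟩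
  | load_execute_forward {ρ μ n buf σ} {i r args pc vs a j v l}
      (hb : buf i = some (.load r args pc)) (hf : NoFence buf i)
      (hv : resolveAll buf ρ i args = some vs) (ha : M.addr (vals vs) = a)
      (hj : j < i) (hbj : buf j = some (.store (.val v) (.resolved (a, l))))
      (hs : NoStore buf a (j + 1) i) :
      Step M P ⟨⟨ρ, μ, n, buf⟩, σ⟩ (.execute i) [.fwd (a, lub vs)]
        ⟨⟨ρ, μ, n, insert buf i (.loadVal r v (j : WithBot ℕ) a pc)⟩, σ⟩
  | load_execute_guess {ρ μ n buf σ} {i r args pc j v sa}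
      (hb : buf i = some (.load r args pc)) (hf : NoFence buf i)
      (hj : j < i) (hbj : buf j = some (.store (.val v) sa)) :
      Step M P ⟨⟨ρ, μ, n, buf⟩, σ⟩ (.executeFwd i j) []
        ⟨⟨ρ, μ, n, insert buf i (.loadFwd r args v j pc)⟩, σ⟩
  | load_addr_ok {ρ μ n buf σ} {i r args pc vs a j v sa}
      (hb : buf i = some (.loadFwd r args v j pc)) (hf : NoFence buf i)
      (hv : resolveAll buf ρ i args = some vs) (ha : M.addr (vals vs) = a)
      (hbj : buf j = some (.store (.val v) sa))
      (hsa : ∀ a' l, sa = .resolved (a', l) → a' = a)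
      (hs : NoStore buf a (j + 1) i) :
      Step M P ⟨⟨ρ, μ, n, buf⟩, σ⟩ (.execute i) [.fwd (a, lub vs)]
        ⟨⟨ρ, μ, n, insert buf i (.loadVal r v (j : WithBot ℕ) a pc)⟩, σ⟩
  | load_addr_hazard {ρ μ n buf σ} {i r args pc vs a j v sa}
      (hb : buf i = some (.loadFwd r args v j pc)) (hf : NoFence buf i)
      (hv : resolveAll buf ρ i args = some vs) (ha : M.addr (vals vs) = a)
      (hbj : buf j = some (.store (.val v) sa))
      (hs : (∃ a' l, sa = .resolved (a', l) ∧ a' ≠ a) ∨ ¬ NoStore buf a (j + 1) i) :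
      Step M P ⟨⟨ρ, μ, n, buf⟩, σ⟩ (.execute i) [.rollback, .fwd (a, lub vs)]
        ⟨⟨ρ, μ, pc, before buf i⟩, before σ i⟩
  | load_mem_match {ρ μ n buf σ} {i r args pc vs a j v}
      (hb : buf i = some (.loadFwd r args v j pc)) (hf : NoFence buf i)
      (hv : resolveAll buf ρ i args = some vs) (ha : M.addr (vals vs) = a)
      (hbj : buf j = none) (hs : NoStore buf a 0 i) (hm : μ a = some v) :
      Step M P ⟨⟨ρ, μ, n, buf⟩, σ⟩ (.execute i) [.read (a, lub vs)]
        ⟨⟨ρ, μ, n, insert buf i (.loadVal r v ⊥ a pc)⟩, σ⟩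
  | load_mem_hazard {ρ μ n buf σ} {i r args pc vs a j v v'}
      (hb : buf i = some (.loadFwd r args v j pc)) (hf : NoFence buf i)
      (hv : resolveAll buf ρ i args = some vs) (ha : M.addr (vals vs) = a)
      (hbj : buf j = none) (hs : NoStore buf a 0 i) (hm : μ a = some v') (hne : v' ≠ v) :
      Step M P ⟨⟨ρ, μ, n, buf⟩, σ⟩ (.execute i) [.rollback, .read (a, lub vs)]
        ⟨⟨ρ, μ, pc, before buf i⟩, before σ i⟩
  | store_execute_value {ρ μ n buf σ} {i src sa v}
      (hb : buf i = some (.store src sa)) (hf : NoFence buf i)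
      (hv : resolve buf ρ i src = some v) :
      Step M P ⟨⟨ρ, μ, n, buf⟩, σ⟩ (.executeValue i) []
        ⟨⟨ρ, μ, n, insert buf i (.store (.val v) sa)⟩, σ⟩
  | store_addr_ok {ρ μ n buf σ} {i src args vs a}
      (hb : buf i = some (.store src (.pending args))) (hf : NoFence buf i)
      (hv : resolveAll buf ρ i args = some vs) (ha : M.addr (vals vs) = a)
      (hk : ∀ k t pc, i < k → buf k = some t → ¬ t.Hazard i a pc) :
      Step M P ⟨⟨ρ, μ, n, buf⟩, σ⟩ (.executeAddr i) [.fwd (a, lub vs)]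
        ⟨⟨ρ, μ, n, insert buf i (.store src (.resolved (a, lub vs)))⟩, σ⟩
  | store_addr_hazard {ρ μ n buf σ} {i src args vs a k t pc}
      (hb : buf i = some (.store src (.pending args))) (hf : NoFence buf i)
      (hv : resolveAll buf ρ i args = some vs) (ha : M.addr (vals vs) = a)
      (hik : i < k) (hbk : buf k = some t) (ht : t.Hazard i a pc)
      (hmin : ∀ k' t' pc', i < k' → k' < k → buf k' = some t' → ¬ t'.Hazard i a pc') :
      Step M P ⟨⟨ρ, μ, n, buf⟩, σ⟩ (.executeAddr i) [.rollback, .fwd (a, lub vs)]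
        ⟨⟨ρ, μ, pc, insert (before buf k) i (.store src (.resolved (a, lub vs)))⟩, before σ k⟩
  | value_retire {ρ μ n buf σ} {i t r v}
      (hi : minIdx buf = i) (hb : buf i = some t) (ht : t.IsVal r v) :
      Step M P ⟨⟨ρ, μ, n, buf⟩, σ⟩ .retire []
        ⟨⟨Function.update ρ r (some v), μ, n, erase buf i⟩, σ⟩
  | jump_retire {ρ μ n buf σ} {i n₀}
      (hi : minIdx buf = i) (hb : buf i = some (.jump n₀)) :
      Step M P ⟨⟨ρ, μ, n, buf⟩, σ⟩ .retire []
        ⟨⟨ρ, μ, n, erase buf i⟩, σ⟩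
  | fence_retire {ρ μ n buf σ} {i}
      (hi : minIdx buf = i) (hb : buf i = some .fence) :
      Step M P ⟨⟨ρ, μ, n, buf⟩, σ⟩ .retire []
        ⟨⟨ρ, μ, n, erase buf i⟩, σ⟩
  | store_retire {ρ μ n buf σ} {i v a l}
      (hi : minIdx buf = i) (hb : buf i = some (.store (.val v) (.resolved (a, l)))) :
      Step M P ⟨⟨ρ, μ, n, buf⟩, σ⟩ .retire [.write (a, l)]
        ⟨⟨ρ, Function.update μ a (some v), n, erase buf i⟩, σ⟩
  | call_retire {ρ μ n buf σ} {i t₁ vsp v a l}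
      (hi : minIdx buf = i) (hb : buf i = some .call)
      (hb₁ : buf (i + 1) = some t₁) (ht₁ : t₁.IsVal M.rsp vsp)
      (hb₂ : buf (i + 2) = some (.store (.val v) (.resolved (a, l)))) :
      Step M P ⟨⟨ρ, μ, n, buf⟩, σ⟩ .retire [.write (a, l)]
        ⟨⟨Function.update ρ M.rsp (some vsp), Function.update μ a (some v), n,
          after buf (i + 2)⟩, σ⟩
  | ret_retire {ρ μ n buf σ} {i t₁ v₁ t₂ v₂ n'}
      (hi : minIdx buf = i) (hb : buf i = some .ret)
      (hb₁ : buf (i + 1) = some t₁) (ht₁ : t₁.IsVal M.rret v₁)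
      (hb₂ : buf (i + 2) = some t₂) (ht₂ : t₂.IsVal M.rsp v₂)
      (hb₃ : buf (i + 3) = some (.jump n')) :
      Step M P ⟨⟨ρ, μ, n, buf⟩, σ⟩ .retire []
        ⟨⟨Function.update ρ M.rsp (some v₂), μ, n, after buf (i + 3)⟩, σ⟩

/-- Steps of a sequential execution: an instruction is fetched only when no instruction is in
flight, so that every earlier one has been executed and retired. -/
def SeqStep (M : Machine V R F B) (P : Program V L R F B) (S : State V L R F B)
    (d : Directive V) (o : List (Obs V L)) (S' : State V L R F B) : Prop :=
  Step M P S d o S' ∧ (d.IsFetch → S.cfg.Terminal)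

/-- Sequences of steps of a given kind, with their schedule and their observations. -/
inductive Steps (T : State V L R F B → Directive V → List (Obs V L) → State V L R F B → Prop) :
    State V L R F B → List (Directive V) → List (Obs V L) → State V L R F B → Prop
  | nil (S) : Steps T S [] [] S
  | cons {S S' S'' d o D O} : T S d o S' → Steps T S' D O S'' → Steps T S (d :: D) (o ++ O) S''

/-- `BigStep M P N S D O S'`: the schedule `D` takes `S` to `S'` with the observations `O`, and
retires `N` instructions. -/
def BigStep (M : Machine V R F B) (P : Program V L R F B) (N : ℕ) (S : State V L R F B)
    (D : List (Directive V)) (O : List (Obs V L)) (S' : State V L R F B) : Prop :=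
  Steps (Step M P) S D O S' ∧ numRetired D = N

/-- `SeqBigStep M P N S O S'`: a sequential execution that retires `N` instructions, from an
initial configuration to a terminal one. -/
def SeqBigStep (M : Machine V R F B) (P : Program V L R F B) (N : ℕ) (S : State V L R F B)
    (O : List (Obs V L)) (S' : State V L R F B) : Prop :=
  S.cfg.Terminal ∧ S'.cfg.Terminal ∧
    ∃ D, Steps (SeqStep M P) S D O S' ∧ numRetired D = N

end Semantics

end Speculative

/-! The proof compares every execution, speculative or sequential, with an in-order machine
`ArchStep` whose state is only a register map, a memory and a program point, and which runs one
whole instruction per step. This machine is deterministic. A `retire` directive is matched by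
exactly one of its steps, and every other directive by none, so an execution with `N` retirements
yields an `ArchRun` of length `N`.

The matching rests on the invariant `Inv`. It carries a ghost sequence `g`, the entries as they were
when fetched, which is cut into groups, one per instruction, along the predicted path from the
architectural point `p₀` to the current point `n`. Each buffer entry is either still as fetched or
the result of executing its ghost entry on the operand values visible at its index (`Tracks`). A
resolved branch or jump therefore has a correct prediction, and the group behind it starts at the
true successor. For a resolved load, `LoadDep` says that its value comes either from the in-flight
store it names or from memory, and that no store with a known address contradicts this. The hazard
checks are what keeps this true when further store addresses become known (`Inv.resolve_addr`).

Execution never changes a value that is already visible, and a rollback cuts the buffer at a point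
where the remaining ghost path is still valid (`Inv.redirect`, `Inv.truncate_load`). When the oldest
group is retired, nothing precedes it, so its operands are architectural values and its effect is an
`ArchStep`. The one discrepancy is that a return does not commit the return register. The hypothesis
on programs makes this harmless: the only entry reading that register is the jump of a return, after
the load of the same return has assigned it (`Group.reads`, `Inv.drop`).

Conversely, each `ArchStep` is realised by fetching, executing and retiring one instruction
(`ArchStep.exists_seq`), which gives existence. A sequential execution is also a speculative one, so
the same simulation applies to it, and determinism gives the agreement. In a terminal configuration
the predicted path is empty, so the program points agree as well. -/

namespace Speculative

set_option linter.unusedSectionVars false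

/-! ### The in-order reference machine. -/

section Architecture

variable {V L R F B : Type*} [DecidableEq V] [DecidableEq R] [Lattice L] [OrderBot L]

/-- One step of the architectural (in-order, one instruction at a time) semantics on register
maps, memories and program points. -/
inductive ArchStep (M : Machine V R F B) (P : Program V L R F B) :
    (R → Option (V × L)) × (V → Option (V × L)) × V →
    (R → Option (V × L)) × (V → Option (V × L)) × V → Prop
  | op {ρ μ p f r args next vs} (hI : P p = some (.op f r args next))
      -- With an empty buffer and index `0`, operands are read from `ρ` alone.
      (hv : resolveAll (fun _ => none : Buf V L R F B) ρ 0 args = some vs) :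
      ArchStep M P (ρ, μ, p)
        (Function.update ρ r (some (M.evalOp f (vals vs), lub vs)), μ, next)
  | br {ρ μ p f args nt nf vs} (hI : P p = some (.br f args nt nf))
      (hv : resolveAll (fun _ => none : Buf V L R F B) ρ 0 args = some vs) :
      ArchStep M P (ρ, μ, p) (ρ, μ, cond (M.evalCond f (vals vs)) nt nf)
  | load {ρ μ p r args next vs v} (hI : P p = some (.load r args next))
      (hv : resolveAll (fun _ => none : Buf V L R F B) ρ 0 args = some vs)
      (hm : μ (M.addr (vals vs)) = some v) :
      ArchStep M P (ρ, μ, p) (Function.update ρ r (some v), μ, next)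
  | store {ρ μ p src args next vs v} (hI : P p = some (.store src args next))
      (hs : resolve (fun _ => none : Buf V L R F B) ρ 0 src = some v)
      (hv : resolveAll (fun _ => none : Buf V L R F B) ρ 0 args = some vs) :
      ArchStep M P (ρ, μ, p) (ρ, Function.update μ (M.addr (vals vs)) (some v), next)
  | jmpi {ρ μ p args vs} (hI : P p = some (.jmpi args))
      (hv : resolveAll (fun _ => none : Buf V L R F B) ρ 0 args = some vs) :
      ArchStep M P (ρ, μ, p) (ρ, μ, M.addr (vals vs))
  | call {ρ μ p nf nr v} (hI : P p = some (.call nf nr)) (hr : ρ M.rsp = some v) :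
      ArchStep M P (ρ, μ, p)
        (Function.update ρ M.rsp (some (M.evalOp M.succ (vals [v]), lub [v])),
          Function.update μ (M.addr [M.evalOp M.succ (vals [v])]) (some (nr, ⊥)), nf)
  | ret {ρ μ p v w} (hI : P p = some .ret) (hr : ρ M.rsp = some v)
      (hm : μ (M.addr (vals [v])) = some w) :
      ArchStep M P (ρ, μ, p)
        -- The return register is not updated, in agreement with the retirement of a return, which
        -- discards its temporary.
        (Function.update ρ M.rsp (some (M.evalOp M.pred (vals [v]), lub [v])), μ,
          M.addr (vals [w]))
  | fence {ρ μ p next} (hI : P p = some (.fence next)) : ArchStep M P (ρ, μ, p) (ρ, μ, next)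

theorem ArchStep.deterministic {M : Machine V R F B} {P : Program V L R F B} {a b c}
    (hb : ArchStep M P a b) (hc : ArchStep M P a c) : b = c := by
  cases hb <;> cases hc <;> simp_all

/-- Runs of the architectural semantics of a given length. -/
inductive ArchRun (M : Machine V R F B) (P : Program V L R F B) : ℕ →
    (R → Option (V × L)) × (V → Option (V × L)) × V →
    (R → Option (V × L)) × (V → Option (V × L)) × V → Prop
  | zero (a) : ArchRun M P 0 a a
  | succ {N a b c} : ArchStep M P a b → ArchRun M P N b c → ArchRun M P (N + 1) a c

theorem ArchRun.deterministic {M : Machine V R F B} {P : Program V L R F B} {N a b c}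
    (hb : ArchRun M P N a b) (hc : ArchRun M P N a c) : b = c := by
  induction hb with
  | zero => cases hc; rfl
  | succ h _ ih =>
    cases hc with
    | succ h' hr =>
      cases h.deterministic h'
      exact ih hr

end Architecture

/-! ### Stability of register resolution under changes of the buffer. -/

section Resolve

variable {V L R F B : Type*} [DecidableEq R]

theorem resolveAll_mono {buf buf' : Buf V L R F B} {ρ ρ' : R → Option (V × L)} {i i' : ℕ}
    {args : List (Operand V L R)} {vs : List (V × L)}
    (h : ∀ o ∈ args, ∀ v, resolve buf ρ i o = some v → resolve buf' ρ' i' o = some v)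
    (hv : resolveAll buf ρ i args = some vs) : resolveAll buf' ρ' i' args = some vs := by
  unfold resolveAll at hv ⊢
  induction args generalizing vs with
  | nil => simpa using hv
  | cons o args ih =>
    simp only [List.mapM_cons, Option.bind_eq_bind, Option.bind_eq_some_iff, Option.pure_def,
      Option.some.injEq] at hv ⊢
    obtain ⟨v, h1, ws, h2, h3⟩ := hv
    exact ⟨v, h o (by simp) v h1, ws, ih (fun o ho => h o (by simp [ho])) h2, h3⟩

theorem resolve_mono {buf buf' : Buf V L R F B} {ρ ρ' : R → Option (V × L)} {i i' : ℕ}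
    {o : Operand V L R} {v : V × L}
    (h : ∀ r, o = .reg r → ∀ v, resolveReg buf ρ i r = some v → resolveReg buf' ρ' i' r = some v)
    (hv : resolve buf ρ i o = some v) : resolve buf' ρ' i' o = some v := by
  cases o with
  | reg r => exact h r rfl v hv
  | val w => exact hv

theorem resolveReg_congr {buf buf' : Buf V L R F B} {ρ : R → Option (V × L)} {i : ℕ}
    (h : ∀ j < i, buf' j = buf j) (r : R) : resolveReg buf' ρ i r = resolveReg buf ρ i r := by
  induction i with
  | zero => rfl
  | succ i ih =>
    simp only [resolveReg, h i (Nat.lt_succ_self i)]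
    rw [ih fun j hj => h j (hj.trans (Nat.lt_succ_self i))]

theorem resolve_congr {buf buf' : Buf V L R F B} {ρ : R → Option (V × L)} {i : ℕ}
    (h : ∀ j < i, buf' j = buf j) : resolve buf' ρ i = resolve buf ρ i := by
  funext o
  cases o with
  | reg r => exact resolveReg_congr h r
  | val v => rfl

theorem resolveAll_congr {buf buf' : Buf V L R F B} {ρ : R → Option (V × L)} {i : ℕ}
    (h : ∀ j < i, buf' j = buf j) (args : List (Operand V L R)) :
    resolveAll buf' ρ i args = resolveAll buf ρ i args := by
  rw [resolveAll, resolveAll, resolve_congr h]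

theorem resolveReg_of_none {buf : Buf V L R F B} {ρ : R → Option (V × L)} {i : ℕ}
    (h : ∀ j < i, buf j = none) (r : R) : resolveReg buf ρ i r = ρ r := by
  induction i with
  | zero => rfl
  | succ i ih =>
    simp only [resolveReg, h i (Nat.lt_succ_self i)]
    exact ih fun j hj => h j (hj.trans (Nat.lt_succ_self i))

theorem resolve_of_none {buf : Buf V L R F B} {ρ : R → Option (V × L)} {i : ℕ}
    (h : ∀ j < i, buf j = none) :
    resolve buf ρ i = resolve (fun _ => none : Buf V L R F B) ρ 0 := by
  funext o
  cases o with
  | reg r => exact resolveReg_of_none h r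
  | val v => rfl

theorem resolveAll_of_none {buf : Buf V L R F B} {ρ : R → Option (V × L)} {i : ℕ}
    (h : ∀ j < i, buf j = none) (args : List (Operand V L R)) :
    resolveAll buf ρ i args = resolveAll (fun _ => none : Buf V L R F B) ρ 0 args := by
  rw [resolveAll, resolveAll, resolve_of_none h]

theorem resolveReg_succ {buf : Buf V L R F B} {ρ : R → Option (V × L)} {i : ℕ}
    {t : Trans V L R F B} (h : buf i = some t) (r : R) :
    resolveReg buf ρ (i + 1) r = if t.dest = some r then t.value else resolveReg buf ρ i r := by
  simp only [resolveReg, h]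

/-- Executing an entry can only make more values visible: an assignment without a value blocks
resolution instead of exposing an older one, so nothing that was visible before can change. -/
theorem resolveReg_insert {buf : Buf V L R F B} {ρ : R → Option (V × L)} {i k : ℕ}
    {u u' : Trans V L R F B} (hu : buf i = some u) (hd : u'.dest = u.dest)
    (hval : ∀ v, u.value = some v → u'.value = some v) {r : R} {v : V × L}
    (h : resolveReg buf ρ k r = some v) : resolveReg (insert buf i u') ρ k r = some v := by
  induction k with
  | zero => exact h
  | succ k ih =>
    by_cases hk : k = i
    · subst hk
      rw [resolveReg_succ hu] at h
      rw [resolveReg_succ (t := u') (by simp [insert]), hd]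
      split_ifs at h ⊢
      · exact hval v h
      · exact ih h
    · have : insert buf i u' k = buf k := by simp [insert, hk]
      simp only [resolveReg, this] at h ⊢
      cases hb : buf k with
      | none => simp only [hb] at h ⊢; exact ih h
      | some t =>
        simp only [hb] at h ⊢
        split_ifs at h ⊢
        · exact h
        · exact ih h

/-- Dropping the entries below `m` does not change what later indices see of a register, if the
register map provides the value seen at `m`, or if the register is assigned in between. -/
theorem resolveReg_drop {buf buf' : Buf V L R F B} {ρ ρ' : R → Option (V × L)} {m k : ℕ} {r : R}
    (hge : ∀ j, m ≤ j → buf' j = buf j) (hlt : ∀ j < m, buf' j = none) (hk : m ≤ k)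
    (h : ρ' r = resolveReg buf ρ m r ∨ ∃ j t, m ≤ j ∧ j < k ∧ buf j = some t ∧ t.dest = some r) :
    resolveReg buf' ρ' k r = resolveReg buf ρ k r := by
  induction k, hk using Nat.le_induction with
  | base =>
    rw [resolveReg_of_none hlt]
    rcases h with h | ⟨j, _, h1, h2, _⟩
    · exact h
    · omega
  | succ k hk ih =>
    have key : (∀ t, buf k = some t → t.dest ≠ some r) →
        resolveReg buf' ρ' k r = resolveReg buf ρ k r := fun hn => by
      refine ih (h.imp_right ?_)
      rintro ⟨j, t, h1, h2, h3, h4⟩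
      refine ⟨j, t, h1, lt_of_le_of_ne (by omega) ?_, h3, h4⟩
      rintro rfl
      exact hn t h3 h4
    simp only [resolveReg, hge k hk]
    cases hb : buf k with
    | none => exact key (by simp [hb])
    | some t =>
      simp only
      split_ifs with hd
      · rfl
      · exact key (by rw [hb]; rintro t' ⟨⟩; exact hd)

end Resolve

/-! ### The invariant that relates the buffer to the predicted path. -/

section Invariant

variable {V L R F B : Type*} [DecidableEq R] [Lattice L] [OrderBot L]

/-- The value `v` of a resolved load at index `i` with address `a` and dependency `dep` is the one
that memory will hold at `a` when the load is the oldest entry, as far as the resolved store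
addresses tell. -/
def LoadDep (buf : Buf V L R F B) (μ : V → Option (V × L)) (i : ℕ) (a : V) (v : V × L)
    (dep : WithBot ℕ) : Prop :=
  (∃ (j : ℕ) (sa : StoreAddr V L R), dep = (j : WithBot ℕ) ∧ j < i ∧
    buf j = some (.store (.val v) sa) ∧ (∀ a' l, sa = .resolved (a', l) → a' = a) ∧
    NoStore buf a (j + 1) i) ∨
  -- The bound covers both a load from memory, with `dep = ⊥`, and one whose store has since
  -- retired. It ensures that an older store still in flight that later resolves to `a` is detected
  -- as a `stale` hazard.
  (μ a = some v ∧ NoStore buf a 0 i ∧ ∀ k, buf k ≠ none → dep < (k : WithBot ℕ))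

/-- Entries other than stores as they are when they have just been fetched. -/
def Trans.Unresolved : Trans V L R F B → Prop
  | .op _ _ _ => True
  | .br _ _ _ _ _ => True
  | .load _ _ _ => True
  | .jmpi _ _ => True
  | .call => True
  | .ret => True
  | .fence => True
  | _ => False

/-- `Tracks M buf ρ μ i t u`: the entry `u` at index `i` results from executing the fetched
instruction `t` on the operand values that are visible at `i`. -/
inductive Tracks (M : Machine V R F B) (buf : Buf V L R F B) (ρ : R → Option (V × L))
    (μ : V → Option (V × L)) (i : ℕ) : Trans V L R F B → Trans V L R F B → Prop
  | refl {t} (h : t.Unresolved) : Tracks M buf ρ μ i t t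
  | op {f r args vs} (hv : resolveAll buf ρ i args = some vs) :
      Tracks M buf ρ μ i (.op f r args) (.val r (M.evalOp f (vals vs), lub vs))
  | br {f args n nt nf vs} (hv : resolveAll buf ρ i args = some vs)
      (hn : cond (M.evalCond f (vals vs)) nt nf = n) :
      Tracks M buf ρ μ i (.br f args n nt nf) (.jump n)
  | jmpi {args n vs} (hv : resolveAll buf ρ i args = some vs) (hn : M.addr (vals vs) = n) :
      Tracks M buf ρ μ i (.jmpi args n) (.jump n)
  | loadFwd {r args v j pc} (hj : j < i) :
      Tracks M buf ρ μ i (.load r args pc) (.loadFwd r args v j pc)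
  | loadVal {r args v dep a pc vs} (hv : resolveAll buf ρ i args = some vs)
      (ha : M.addr (vals vs) = a) (hd : LoadDep buf μ i a v dep) :
      Tracks M buf ρ μ i (.load r args pc) (.loadVal r v dep a pc)
  | store {src args src' sa}
      (hs : src' = src ∨ ∃ v, src' = .val v ∧ resolve buf ρ i src = some v)
      (hv : sa = .pending args ∨
        ∃ vs, resolveAll buf ρ i args = some vs ∧ sa = .resolved (M.addr (vals vs), lub vs)) :
      Tracks M buf ρ μ i (.store src (.pending args)) (.store src' sa)

/-- The operands that an unresolved transient instruction reads. -/
def Trans.reads : Trans V L R F B → List (Operand V L R)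
  | .op _ _ args => args
  | .br _ args _ _ _ => args
  | .load _ args _ => args
  | .store src (.pending args) => src :: args
  | .jmpi args _ => args
  | _ => []

theorem Tracks.dest_eq {M : Machine V R F B} {buf : Buf V L R F B} {ρ μ i t u}
    (h : Tracks M buf ρ μ i t u) : u.dest = t.dest := by
  cases h <;> rfl

/-- An entry depends on its surroundings only through the registers its fetched form reads and, for
a resolved load, through `LoadDep`. Restricting to the registers actually read is what allows the
return register to change when a return retires. -/
theorem Tracks.mono {M : Machine V R F B} {buf buf' : Buf V L R F B} {ρ ρ' μ μ' i t u}
    (h : Tracks M buf ρ μ i t u)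
    (hr : ∀ r, Operand.reg r ∈ t.reads → ∀ v, resolveReg buf ρ i r = some v →
      resolveReg buf' ρ' i r = some v)
    (hd : ∀ r v dep a pc, u = .loadVal r v dep a pc → LoadDep buf μ i a v dep →
      LoadDep buf' μ' i a v dep) : Tracks M buf' ρ' μ' i t u := by
  have hall : ∀ args vs, (∀ o ∈ args, o ∈ t.reads) → resolveAll buf ρ i args = some vs →
      resolveAll buf' ρ' i args = some vs := fun args vs hsub hv =>
    resolveAll_mono (fun o ho v hov =>
      resolve_mono (fun r hor => hr r (hor ▸ hsub o ho)) hov) hv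
  cases h with
  | refl h => exact .refl h
  | op hv => exact .op (hall _ _ (fun o ho => ho) hv)
  | br hv hn => exact .br (hall _ _ (fun o ho => ho) hv) hn
  | jmpi hv hn => exact .jmpi (hall _ _ (fun o ho => ho) hv) hn
  | loadFwd hj => exact .loadFwd hj
  | loadVal hv ha h => exact .loadVal (hall _ _ (fun o ho => ho) hv) ha (hd _ _ _ _ _ rfl h)
  | store hs hv =>
    refine .store (hs.imp_right ?_) (hv.imp_right ?_)
    · rintro ⟨v, h1, h2⟩
      exact ⟨v, h1, resolve_mono (fun r hor => hr r (by simp [Trans.reads, hor])) h2⟩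
    · rintro ⟨vs, h1, h2⟩
      exact ⟨vs, hall _ _ (fun o ho => List.mem_cons_of_mem _ ho) h1, h2⟩

theorem NoStore.congr {buf buf' : Buf V L R F B} {a : V} {lo i : ℕ}
    (h : NoStore buf a lo i) (hb : ∀ j < i, buf' j = buf j) : NoStore buf' a lo i :=
  fun j t h1 h2 h3 => h j t h1 h2 (by rw [← hb j h2, h3])

theorem LoadDep.congr {buf buf' : Buf V L R F B} {μ : V → Option (V × L)} {i a v dep}
    (h : LoadDep buf μ i a v dep) (hi : buf i ≠ none) (hb : ∀ j < i, buf' j = buf j) :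
    LoadDep buf' μ i a v dep := by
  rcases h with ⟨j, sa, h1, h2, h3, h4, h5⟩ | ⟨h1, h2, h3⟩
  · exact .inl ⟨j, sa, h1, h2, by rw [hb j h2, h3], h4, h5.congr hb⟩
  · refine .inr ⟨h1, h2.congr hb, fun k hk => ?_⟩
    by_cases hki : k < i
    · exact h3 k (by rwa [← hb k hki])
    -- An index outside the common part is at least `i`, and `dep` lies below `i` because the load
    -- is itself a live entry.
    · exact (h3 i hi).trans_le (by exact_mod_cast not_lt.mp hki)

theorem Tracks.congr {M : Machine V R F B} {buf buf' : Buf V L R F B} {ρ μ i t u}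
    (h : Tracks M buf ρ μ i t u) (hi : buf i ≠ none) (hb : ∀ j < i, buf' j = buf j) :
    Tracks M buf' ρ μ i t u :=
  h.mono (fun r _ v hv => by rwa [resolveReg_congr hb]) (fun _ _ _ _ _ _ hd => hd.congr hi hb)

/-- `Group M P g (i, p) (i', p')`: from index `i` on, `g` starts with the entries that fetching the
instruction at `p` adds; they end before `i'`, and fetching continues at `p'`. In the case `orphan`
the load of a return has been rolled back, which leaves a single entry behind. -/
inductive Group (M : Machine V R F B) (P : Program V L R F B) (g : ℕ → Trans V L R F B) :
    ℕ × V → ℕ × V → Prop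
  | simple {i p I t n} (hI : P p = some I) (ht : I.simple p = some (t, n)) (hg : g i = t) :
      Group M P g (i, p) (i + 1, n)
  | br {i p f args nt nf n} (hI : P p = some (.br f args nt nf))
      (hg : g i = .br f args n nt nf) : Group M P g (i, p) (i + 1, n)
  | jmpi {i p args n} (hI : P p = some (.jmpi args)) (hg : g i = .jmpi args n) :
      Group M P g (i, p) (i + 1, n)
  | call {i p nf nr} (hI : P p = some (.call nf nr)) (hg : g i = .call)
      (hg₁ : g (i + 1) = .op M.succ M.rsp [.reg M.rsp])
      (hg₂ : g (i + 2) = .store (.val (nr, ⊥)) (.pending [.reg M.rsp])) :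
      Group M P g (i, p) (i + 3, nf)
  | ret {i p n} (hI : P p = some .ret) (hg : g i = .ret)
      (hg₁ : g (i + 1) = .load M.rret [.reg M.rsp] p)
      (hg₂ : g (i + 2) = .op M.pred M.rsp [.reg M.rsp])
      (hg₃ : g (i + 3) = .jmpi [.reg M.rret] n) :
      Group M P g (i, p) (i + 4, n)
  | orphan {i p} (hI : P p = some .ret) (hg : g i = .ret) : Group M P g (i, p) (i + 1, p)

theorem Group.lt {M : Machine V R F B} {P : Program V L R F B} {g x y}
    (h : Group M P g x y) : x.1 < y.1 := by
  cases h <;> simp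

theorem Group.congr {M : Machine V R F B} {P : Program V L R F B} {g g' x y}
    (h : Group M P g x y) (hg : ∀ j < y.1, g' j = g j) : Group M P g' x y := by
  cases h with
  | simple hI ht h => exact .simple hI ht (by rw [hg _ (by simp), h])
  | br hI h => exact .br hI (by rw [hg _ (by simp), h])
  | jmpi hI h => exact .jmpi hI (by rw [hg _ (by simp), h])
  | call hI h h1 h2 =>
    exact .call hI (by rw [hg _ (by simp), h]) (by rw [hg _ (by simp), h1])
      (by rw [hg _ (by simp), h2])
  | ret hI h h1 h2 h3 =>
    exact .ret hI (by rw [hg _ (by simp), h]) (by rw [hg _ (by simp), h1])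
      (by rw [hg _ (by simp), h2]) (by rw [hg _ (by simp), h3])
  | orphan hI h => exact .orphan hI (by rw [hg _ (by simp), h])

/-- Consecutive groups. -/
abbrev Chain (M : Machine V R F B) (P : Program V L R F B) (g : ℕ → Trans V L R F B) :
    ℕ × V → ℕ × V → Prop :=
  Relation.ReflTransGen (Group M P g)

theorem Chain.le {M : Machine V R F B} {P : Program V L R F B} {g x y}
    (h : Chain M P g x y) : x.1 ≤ y.1 := by
  induction h with
  | refl => exact le_rfl
  | tail _ h ih => exact ih.trans h.lt.le

theorem Chain.congr {M : Machine V R F B} {P : Program V L R F B} {g g' x y}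
    (h : Chain M P g x y) (hg : ∀ j < y.1, g' j = g j) : Chain M P g' x y := by
  induction h with
  | refl => exact .refl
  | tail _ h ih => exact (ih fun j hj => hg j (hj.trans h.lt)).tail (h.congr hg)

/-- The group that covers a given index. -/
theorem Chain.exists_group {M : Machine V R F B} {P : Program V L R F B} {g x y}
    (h : Chain M P g x y) {k : ℕ} (hx : x.1 ≤ k) (hy : k < y.1) :
    ∃ b c, Chain M P g x b ∧ Group M P g b c ∧ b.1 ≤ k ∧ k < c.1 ∧ c.1 ≤ y.1 := by
  induction h with
  | refl => omega
  | @tail b c hc hg ih =>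
    by_cases hk : k < b.1
    · obtain ⟨b', c', h1, h2, h3, h4, h5⟩ := ih hk
      exact ⟨b', c', h1, h2, h3, h4, h5.trans hg.lt.le⟩
    · exact ⟨b, c, hc, hg, not_lt.mp hk, hy, le_rfl⟩

/-- The entries of a group read the return register only where the group has assigned it. -/
theorem Group.reads {M : Machine V R F B} {P : Program V L R F B}
    (hP : ∀ n I, P n = some I → Operand.reg M.rret ∉ I.operands) {g x y}
    (h : Group M P g x y) {i : ℕ} (hx : x.1 ≤ i) (hy : i < y.1) {r : R}
    (hr : Operand.reg r ∈ (g i).reads) :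
    r ≠ M.rret ∨ ∃ j, x.1 ≤ j ∧ j < i ∧ (g j).dest = some r := by
  cases h with
  | @simple k p I t n hI ht hg =>
    left
    rintro rfl
    obtain rfl : i = k := by simp at hx hy; omega
    rw [hg] at hr
    refine hP _ _ hI ?_
    cases I <;> simp [Instr.simple] at ht <;> obtain ⟨rfl, rfl⟩ := ht <;>
      simp_all [Trans.reads, Instr.operands]
  | @br k p _ _ _ _ _ hI hg =>
    left
    rintro rfl
    obtain rfl : i = k := by simp at hx hy; omega
    rw [hg] at hr
    exact hP _ _ hI hr
  | @jmpi k p _ _ hI hg =>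
    left
    rintro rfl
    obtain rfl : i = k := by simp at hx hy; omega
    rw [hg] at hr
    exact hP _ _ hI hr
  | @call k p nf nr hI h h1 h2 =>
    left
    have hi : i = k ∨ i = k + 1 ∨ i = k + 2 := by simp at hx hy; omega
    rcases hi with rfl | rfl | rfl
    · simp [h, Trans.reads] at hr
    · simp only [h1, Trans.reads, List.mem_singleton, Operand.reg.injEq] at hr
      exact hr ▸ M.rsp_ne_rret
    · simp only [h2, Trans.reads, List.mem_cons, reduceCtorEq, false_or, Operand.reg.injEq,
        List.not_mem_nil, or_false] at hr
      exact hr ▸ M.rsp_ne_rret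
  | @ret k p n hI h h1 h2 h3 =>
    have hi : i = k ∨ i = k + 1 ∨ i = k + 2 ∨ i = k + 3 := by simp at hx hy; omega
    rcases hi with rfl | rfl | rfl | rfl
    · simp [h, Trans.reads] at hr
    · simp only [h1, Trans.reads, List.mem_singleton, Operand.reg.injEq] at hr
      exact .inl (hr ▸ M.rsp_ne_rret)
    · simp only [h2, Trans.reads, List.mem_singleton, Operand.reg.injEq] at hr
      exact .inl (hr ▸ M.rsp_ne_rret)
    · simp only [h3, Trans.reads, List.mem_singleton, Operand.reg.injEq] at hr
      -- The jump of a return reads the register that the load at `k + 1` has assigned.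
      exact .inr ⟨k + 1, by simp, by omega, by rw [h1, hr]; rfl⟩
  | @orphan k p hI h =>
    obtain rfl : i = k := by simp at hx hy; omega
    simp [h, Trans.reads] at hr

theorem Chain.reads {M : Machine V R F B} {P : Program V L R F B}
    (hP : ∀ n I, P n = some I → Operand.reg M.rret ∉ I.operands) {g x y}
    (h : Chain M P g x y) {i : ℕ} (hx : x.1 ≤ i) (hy : i < y.1) {r : R}
    (hr : Operand.reg r ∈ (g i).reads) :
    r ≠ M.rret ∨ ∃ j, x.1 ≤ j ∧ j < i ∧ (g j).dest = some r := by
  obtain ⟨b, c, hb, hg, h1, h2, -⟩ := h.exists_group hx hy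
  refine (hg.reads hP h1 h2 hr).imp_right ?_
  rintro ⟨j, h3, h4⟩
  exact ⟨j, Chain.le hb |>.trans h3, h4⟩

/-- The invariant of speculative executions: the buffer occupies the indices `i₀ ≤ i < e` and
tracks the instructions `g` on the predicted path from `p₀` to `n`. -/
structure Inv (M : Machine V R F B) (P : Program V L R F B) (ρ : R → Option (V × L))
    (μ : V → Option (V × L)) (n : V) (buf : Buf V L R F B) (i₀ : ℕ) (p₀ : V) (e : ℕ)
    (g : ℕ → Trans V L R F B) : Prop where
  chain : Chain M P g (i₀, p₀) (e, n)
  range : ∀ i, buf i ≠ none → i₀ ≤ i ∧ i < e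
  tracks : ∀ i, i₀ ≤ i → i < e → ∃ u, buf i = some u ∧ Tracks M buf ρ μ i (g i) u

namespace Inv

variable {M : Machine V R F B} {P : Program V L R F B} {ρ : R → Option (V × L)}
  {μ : V → Option (V × L)} {n : V} {buf : Buf V L R F B} {i₀ : ℕ} {p₀ : V} {e : ℕ}
  {g : ℕ → Trans V L R F B}

theorem range' (h : Inv M P ρ μ n buf i₀ p₀ e g) {i u} (hi : buf i = some u) : i₀ ≤ i ∧ i < e :=
  h.range i (by simp [hi])

theorem none_of_lt (h : Inv M P ρ μ n buf i₀ p₀ e g) {j} (hj : j < i₀) : buf j = none := by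
  by_contra hne
  exact absurd (h.range j hne).1 (by omega)

theorem tracks' (h : Inv M P ρ μ n buf i₀ p₀ e g) {i u} (hi : buf i = some u) :
    Tracks M buf ρ μ i (g i) u := by
  obtain ⟨h1, h2⟩ := h.range' hi
  obtain ⟨u', h3, h4⟩ := h.tracks i h1 h2
  rw [hi] at h3
  cases h3
  exact h4

theorem le (h : Inv M P ρ μ n buf i₀ p₀ e g) : i₀ ≤ e := Chain.le h.chain

theorem minIdx_eq (h : Inv M P ρ μ n buf i₀ p₀ e g) (hlt : i₀ < e) : minIdx buf = i₀ := by
  obtain ⟨u, hu, -⟩ := h.tracks i₀ le_rfl hlt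
  exact IsLeast.csInf_eq ⟨by simp [hu], fun j hj => (h.range j hj).1⟩

theorem minIdx_eq' (h : Inv M P ρ μ n buf i₀ p₀ e g) {t} (ht : buf (minIdx buf) = some t) :
    minIdx buf = i₀ ∧ i₀ < e := by
  have := h.range' ht
  have hlt : i₀ < e := by omega
  exact ⟨h.minIdx_eq hlt, hlt⟩

theorem fresh_eq (h : Inv M P ρ μ n buf i₀ p₀ e g) (hlt : i₀ < e) : fresh buf = e := by
  obtain ⟨u, hu, -⟩ := h.tracks (e - 1) (by omega) (by omega)
  have : maxIdx buf = e - 1 :=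
    IsGreatest.csSup_eq ⟨by simp [hu], fun j hj => by have := (h.range j hj).2; omega⟩
  rw [fresh, this]
  omega

/-- An empty buffer fits any starting index, which permits renumbering whenever nothing is in
flight. -/
theorem of_none (hn : ∀ i, buf i = none) (i₀ : ℕ) : Inv M P ρ μ n buf i₀ n i₀ g :=
  ⟨.refl, fun i hi => absurd (hn i) hi, fun i h1 h2 => by omega⟩

theorem eq_none (h : Inv M P ρ μ n buf i₀ p₀ i₀ g) : (∀ i, buf i = none) ∧ n = p₀ := by
  refine ⟨fun i => ?_, ?_⟩
  · by_contra hne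
    have := h.range i hne
    omega
  · rcases Relation.ReflTransGen.cases_head h.chain with h1 | ⟨c, h1, h2⟩
    · cases h1; rfl
    · have := h1.lt
      have := Chain.le h2
      simp at *
      omega

/-- With nothing in flight the predicted path is empty, so fetching stands at the architectural
program point. -/
theorem of_terminal (h : Inv M P ρ μ n buf i₀ p₀ e g) (hn : ∀ i, buf i = none) : n = p₀ := by
  rcases h.le.eq_or_lt with rfl | hlt
  · exact h.eq_none.2
  · obtain ⟨u, hu, -⟩ := h.tracks i₀ le_rfl hlt
    simp [hn] at hu

/-- Numbering restarts when the buffer is empty, and the end index of the invariant may then differ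
from the fresh one. In that case the invariant is anchored again at the fresh index. -/
theorem exists_fresh (h : Inv M P ρ μ n buf i₀ p₀ e g) :
    ∃ i₁, Inv M P ρ μ n buf i₁ p₀ (fresh buf) g := by
  rcases h.le.eq_or_lt with rfl | hlt
  · obtain ⟨h1, rfl⟩ := h.eq_none
    exact ⟨_, of_none h1 _⟩
  · exact ⟨i₀, h.fresh_eq hlt ▸ h⟩

/-- Deleting the entries from a group boundary on. -/
theorem truncate (h : Inv M P ρ μ n buf i₀ p₀ e g) {k : ℕ} {q : V}
    (hc : Chain M P g (i₀, p₀) (k, q)) (hk : k ≤ e) :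
    Inv M P ρ μ q (before buf k) i₀ p₀ k g := by
  refine ⟨hc, fun i hi => ?_, fun i h1 h2 => ?_⟩
  · simp only [before] at hi
    split_ifs at hi with hik
    · exact ⟨(h.range i hi).1, hik⟩
    · exact absurd rfl hi
  · obtain ⟨u, h3, h4⟩ := h.tracks i h1 (by omega)
    exact ⟨u, by simp [before, h2, h3], h4.congr (by simp [h3])
      fun j hj => by simp [before, hj.trans h2]⟩

/-- Adding a group at the end. -/
theorem append (h : Inv M P ρ μ n buf i₀ p₀ e g) {g' : ℕ → Trans V L R F B} {e' : ℕ} {n' : V}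
    {buf' : Buf V L R F B} (hG : Group M P g' (e, n) (e', n')) (hg : ∀ j < e, g' j = g j)
    (hb : ∀ j < e, buf' j = buf j) (hr : ∀ j, e' ≤ j → buf' j = none)
    (ht : ∀ j, e ≤ j → j < e' → ∃ u, buf' j = some u ∧ Tracks M buf' ρ μ j (g' j) u) :
    Inv M P ρ μ n' buf' i₀ p₀ e' g' := by
  have hlt : e < e' := hG.lt
  have hle := h.le
  refine ⟨Relation.ReflTransGen.tail (Chain.congr h.chain hg) hG, fun i hi => ?_,
    fun i h1 h2 => ?_⟩
  · have hi' : i < e' := by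
      by_contra hc
      exact hi (hr i (not_lt.mp hc))
    by_cases hie : i < e
    · exact ⟨(h.range i (by rwa [← hb i hie])).1, hi'⟩
    · omega
  · by_cases hie : i < e
    · obtain ⟨u, h3, h4⟩ := h.tracks i h1 hie
      exact ⟨u, by rw [hb i hie, h3], by
        rw [hg i hie]
        exact h4.congr (by simp [h3]) fun j hj => hb j (hj.trans hie)⟩
    · exact ht i (not_lt.mp hie) h2

/-- Executing the entry at an index. -/
theorem insert (h : Inv M P ρ μ n buf i₀ p₀ e g) {i : ℕ} {u u' : Trans V L R F B}
    (hu : buf i = some u) (ht : Tracks M buf ρ μ i (g i) u')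
    (hval : ∀ v, u.value = some v → u'.value = some v)
    (hL : ∀ k r v dep a pc, insert buf i u' k = some (.loadVal r v dep a pc) →
      LoadDep buf μ k a v dep → LoadDep (insert buf i u') μ k a v dep) :
    Inv M P ρ μ n (Speculative.insert buf i u') i₀ p₀ e g := by
  -- Both entries track the same fetched instruction, so they assign the same register.
  have hd : u'.dest = u.dest := by rw [ht.dest_eq, (h.tracks' hu).dest_eq]
  refine ⟨h.chain, fun j hj => ?_, fun j h1 h2 => ?_⟩
  · by_cases hji : j = i
    · exact hji ▸ h.range' hu
    · exact h.range j (by simpa [Speculative.insert, hji] using hj)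
  · have key : ∀ w, Speculative.insert buf i u' j = some w → Tracks M buf ρ μ j (g j) w →
        ∃ u, Speculative.insert buf i u' j = some u ∧
          Tracks M (Speculative.insert buf i u') ρ μ j (g j) u := fun w hw hT =>
      ⟨w, hw, hT.mono (fun r _ v hv => resolveReg_insert hu hd hval hv)
        (fun r v dep a pc hwl => hL j r v dep a pc (by rw [hw, hwl]))⟩
    by_cases hji : j = i
    · subst hji
      exact key u' (by simp [Speculative.insert]) ht
    · obtain ⟨w, h3, h4⟩ := h.tracks j h1 h2
      exact key w (by simp [Speculative.insert, hji, h3]) h4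

/-- Executing an entry without resolving the address of a store. -/
theorem insert' (h : Inv M P ρ μ n buf i₀ p₀ e g) {i : ℕ} {u u' : Trans V L R F B}
    (hu : buf i = some u) (ht : Tracks M buf ρ μ i (g i) u')
    (hval : ∀ v, u.value = some v → u'.value = some v)
    (hst : ∀ a, u'.StoresTo a → u.StoresTo a)
    (hsv : ∀ v sa, u = .store (.val v) sa → u' = .store (.val v) sa) :
    Inv M P ρ μ n (Speculative.insert buf i u') i₀ p₀ e g := by
  refine h.insert hu ht hval fun k r v dep a pc _ hd => ?_
  have hN : ∀ lo, NoStore buf a lo k → NoStore (Speculative.insert buf i u') a lo k := by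
    intro lo hno j t h1 h2 h3 h4
    by_cases hji : j = i
    · subst hji
      simp only [Speculative.insert, Function.update_self, Option.some.injEq] at h3
      exact hno j u h1 h2 hu (hst a (h3 ▸ h4))
    · exact hno j t h1 h2 (by simpa [Speculative.insert, hji] using h3) h4
  rcases hd with ⟨j, sa, h1, h2, h3, h4, h5⟩ | ⟨h1, h2, h3⟩
  · refine .inl ⟨j, sa, h1, h2, ?_, h4, hN _ h5⟩
    by_cases hji : j = i
    · subst hji
      rw [hu, Option.some.injEq] at h3
      simp [Speculative.insert, hsv v sa h3]
    · simpa [Speculative.insert, hji] using h3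
  · refine .inr ⟨h1, hN _ h2, fun j hj => h3 j ?_⟩
    by_cases hji : j = i
    · simp [hji, hu]
    · simpa [Speculative.insert, hji] using hj

/-- Resolving the address of a store, if there is no conflicting load. -/
theorem resolve_addr (h : Inv M P ρ μ n buf i₀ p₀ e g) {i : ℕ} {src : Operand V L R}
    {args : List (Operand V L R)} {vs : List (V × L)} {a : V}
    (hb : buf i = some (.store src (.pending args))) (hv : resolveAll buf ρ i args = some vs)
    (ha : M.addr (vals vs) = a)
    (hk : ∀ k t pc, i < k → buf k = some t → ¬ t.Hazard i a pc) :
    Inv M P ρ μ n (Speculative.insert buf i (.store src (.resolved (a, lub vs)))) i₀ p₀ e g := by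
  subst ha
  refine h.insert hb ?_ (by simp [Trans.value]) ?_
  · have ht := h.tracks' hb
    generalize g i = t at ht
    cases ht with
    | refl h => exact h.elim
    | store hs hv' =>
      refine .store hs (.inr ⟨vs, ?_, rfl⟩)
      rcases hv' with hv' | ⟨_, _, hv'⟩
      · cases hv'; exact hv
      · cases hv'
  · intro k r v dep a pc hbk hd
    have hki : k ≠ i := by
      rintro rfl
      simp [Speculative.insert] at hbk
    replace hbk : buf k = some (.loadVal r v dep a pc) := by
      simpa [Speculative.insert, hki] using hbk
    -- The newly resolved store can break `NoStore` only if it lies in the range and has the address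
    -- of the load.
    have hN : ∀ lo, (lo ≤ i → i < k → a ≠ M.addr (vals vs)) → NoStore buf a lo k →
        NoStore (Speculative.insert buf i (.store src (.resolved (M.addr (vals vs), lub vs))))
          a lo k := by
      intro lo hne hno j t h1 h2 h3 h4
      by_cases hji : j = i
      · subst hji
        simp only [Speculative.insert, Function.update_self, Option.some.injEq] at h3
        obtain ⟨_, _, h4⟩ := h4
        rw [← h3] at h4
        simp only [Trans.store.injEq, StoreAddr.resolved.injEq, Prod.mk.injEq] at h4
        exact hne h1 h2 h4.2.1.symm
      · exact hno j t h1 h2 (by simpa [Speculative.insert, hji] using h3) h4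
    rcases hd with ⟨j, sa, h1, h2, h3, h4, h5⟩ | ⟨h1, h2, h3⟩
    · subst h1
      by_cases hji : j = i
      · subst hji
        rw [hb, Option.some.injEq, Trans.store.injEq] at h3
        refine .inl ⟨j, .resolved (M.addr (vals vs), lub vs), rfl, h2,
          by simp [Speculative.insert, h3.1], ?_, hN _ (by omega) h5⟩
        rintro a' l ⟨⟩
        by_contra hne
        -- The load took its value from this very store, so a different address would be a
        -- misforwarding hazard.
        exact hk k _ pc h2 hbk (.misforward r v a (Ne.symm hne))
      · refine .inl ⟨j, sa, rfl, h2, by simpa [Speculative.insert, hji] using h3, h4,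
          hN _ (fun hl hik => ?_) h5⟩
        rintro rfl
        -- Here the load depends on a store older than `i`, so a matching address at `i` would make
        -- it stale.
        exact hk k _ pc hik hbk (.stale r v _ (by exact_mod_cast hl))
    · refine .inr ⟨h1, hN _ (fun hl hik => ?_) h2, fun j hj => h3 j ?_⟩
      · rintro rfl
        -- The store at `i` is live, hence above `dep`, and the load would again be stale.
        exact hk k _ pc hik hbk (.stale r v _ (h3 i (by simp [hb])))
      · by_cases hji : j = i
        · simp [hji, hb]
        · simpa [Speculative.insert, hji] using hj

end Inv

end Invariant

/-! ### Preservation of the invariant under retirement, rollback and fetch. -/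

section Preservation

variable {V L R F B : Type*} [DecidableEq V] [DecidableEq R] [Lattice L] [OrderBot L]

/-- Removing the entries below `m` when they contain no store. -/
theorem LoadDep.drop {buf buf' : Buf V L R F B} {μ : V → Option (V × L)} {m k a v dep}
    (h : LoadDep buf μ k a v dep) (hge : ∀ j, m ≤ j → buf' j = buf j)
    (hlt : ∀ j < m, buf' j = none) (hs : ∀ j < m, ∀ src sa, buf j ≠ some (.store src sa)) :
    LoadDep buf' μ k a v dep := by
  have hsome : ∀ {j t}, buf' j = some t → m ≤ j ∧ buf j = some t := fun {j t} hj => by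
    by_cases hjm : j < m
    · simp [hlt j hjm] at hj
    · exact ⟨not_lt.mp hjm, by rw [← hge j (not_lt.mp hjm), hj]⟩
  have hN : ∀ {lo}, NoStore buf a lo k → NoStore buf' a lo k := fun h j t h1 h2 h3 =>
    h j t h1 h2 (hsome h3).2
  rcases h with ⟨j, sa, h1, h2, h3, h4, h5⟩ | ⟨h1, h2, h3⟩
  · have hj : m ≤ j := by
      by_contra hc
      exact hs j (by omega) _ _ h3
    exact .inl ⟨j, sa, h1, h2, by rw [hge j hj, h3], h4, hN h5⟩
  · refine .inr ⟨h1, hN h2, fun j hj => ?_⟩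
    obtain ⟨t, ht⟩ := Option.ne_none_iff_exists'.mp hj
    exact h3 j (by simp [(hsome ht).2])

/-- Removing the entries up to a store at `s`, the first one, and writing its value to memory. -/
theorem LoadDep.drop_store {buf buf' : Buf V L R F B} {μ : V → Option (V × L)} {s k a v dep}
    {a₀ : V} {l : L} {v₀ : V × L} (h : LoadDep buf μ k a v dep) (hsk : s < k)
    (hge : ∀ j, s < j → buf' j = buf j) (hlt : ∀ j ≤ s, buf' j = none)
    (hs : ∀ j < s, ∀ src sa, buf j ≠ some (.store src sa))
    (hb : buf s = some (.store (.val v₀) (.resolved (a₀, l)))) :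
    LoadDep buf' (Function.update μ a₀ (some v₀)) k a v dep := by
  have hsome : ∀ {j t}, buf' j = some t → s < j ∧ buf j = some t := fun {j t} hj => by
    by_cases hjm : j ≤ s
    · simp [hlt j hjm] at hj
    · exact ⟨not_le.mp hjm, by rw [← hge j (not_le.mp hjm), hj]⟩
  rcases h with ⟨j, sa, rfl, h2, h3, h4, h5⟩ | ⟨h1, h2, h3⟩
  · rcases lt_trichotomy j s with hj | rfl | hj
    · exact absurd h3 (hs j hj _ _)
    · rw [hb, Option.some.injEq, Trans.store.injEq, Operand.val.injEq] at h3
      obtain ⟨rfl, rfl⟩ := h3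
      obtain rfl := h4 _ _ rfl
      -- The load was fed by the store being retired: memory now holds its value, and `dep = s` lies
      -- below all remaining indices.
      refine .inr ⟨by simp, fun j' t h6 h7 h8 => ?_, fun j' hj' => ?_⟩
      · exact h5 j' t (hsome h8).1 h7 (hsome h8).2
      · obtain ⟨t, ht⟩ := Option.ne_none_iff_exists'.mp hj'
        exact_mod_cast (hsome ht).1
    · exact .inl ⟨j, sa, rfl, h2, by rw [hge j hj, h3], h4,
        fun j' t h6 h7 h8 => h5 j' t h6 h7 (hsome h8).2⟩
  · have hne : a ≠ a₀ := by
      rintro rfl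
      exact h2 s _ (Nat.zero_le s) hsk hb ⟨_, _, rfl⟩
    refine .inr ⟨by rw [Function.update_of_ne hne, h1],
      fun j' t h6 h7 h8 => h2 j' t h6 h7 (hsome h8).2, fun j' hj' => ?_⟩
    obtain ⟨t, ht⟩ := Option.ne_none_iff_exists'.mp hj'
    exact h3 j' (by simp [(hsome ht).2])

/-- When no older store is in flight, the value of a resolved load is the one in memory. -/
theorem LoadDep.mem_eq {buf : Buf V L R F B} {μ : V → Option (V × L)} {k a v dep}
    (h : LoadDep buf μ k a v dep) (hs : ∀ j < k, ∀ src sa, buf j ≠ some (.store src sa)) :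
    μ a = some v := by
  rcases h with ⟨j, sa, -, h2, h3, -⟩ | ⟨h1, -⟩
  · exact absurd h3 (hs j h2 _ _)
  · exact h1

namespace Inv

variable {M : Machine V R F B} {P : Program V L R F B} {ρ : R → Option (V × L)}
  {μ : V → Option (V × L)} {n : V} {buf : Buf V L R F B} {i₀ : ℕ} {p₀ : V} {e : ℕ}
  {g : ℕ → Trans V L R F B}

/-- Retiring the first group. -/
theorem drop (hP : ∀ n I, P n = some I → Operand.reg M.rret ∉ I.operands)
    (h : Inv M P ρ μ n buf i₀ p₀ e g) {m : ℕ} {p₁ : V} (hG : Group M P g (i₀, p₀) (m, p₁))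
    (hc : Chain M P g (m, p₁) (e, n)) {buf' : Buf V L R F B}
    (hge : ∀ j, m ≤ j → buf' j = buf j) (hlt : ∀ j < m, buf' j = none)
    {ρ' : R → Option (V × L)} (hρ : ∀ r, r ≠ M.rret → ρ' r = resolveReg buf ρ m r)
    {μ' : V → Option (V × L)}
    (hμ : ∀ k a v dep, m ≤ k → LoadDep buf μ k a v dep → LoadDep buf' μ' k a v dep) :
    Inv M P ρ' μ' n buf' m p₁ e g := by
  have him : i₀ < m := hG.lt
  refine ⟨hc, fun i hi => ?_, fun i h1 h2 => ?_⟩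
  · have hm : m ≤ i := by
      by_contra hcon
      exact hi (hlt i (by omega))
    exact ⟨hm, (h.range i (by rwa [← hge i hm])).2⟩
  · obtain ⟨u, h3, h4⟩ := h.tracks i (by omega) h2
    refine ⟨u, by rw [hge i h1, h3], h4.mono (fun r hr v hv => ?_)
      fun _ _ _ _ _ _ hd => hμ _ _ _ _ h1 hd⟩
    rw [resolveReg_drop hge hlt h1 ?_, hv]
    -- Only the return register may look different after the removal, and a remaining entry that
    -- reads it is preceded by an assignment that also remains.
    refine (Chain.reads hP hc h1 h2 hr).imp (hρ r) ?_
    rintro ⟨j, h5, h6, h7⟩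
    simp only at h5
    obtain ⟨w, h8, h9⟩ := h.tracks j (by omega) (by omega)
    exact ⟨j, w, h5, h6, h8, by rw [h9.dest_eq, h7]⟩

/-- Deleting the entries from a load on, and fetching it again. -/
theorem truncate_load (h : Inv M P ρ μ n buf i₀ p₀ e g) {k : ℕ} {r args pc}
    (hi : i₀ ≤ k) (hk : k < e) (hg : g k = .load r args pc) :
    Inv M P ρ μ pc (before buf k) i₀ p₀ k g := by
  obtain ⟨⟨b, p⟩, c, hb, hG, h1, h2, h3⟩ := Chain.exists_group h.chain hi hk
  cases hG with
  | @simple _ _ I t n hI ht hgb =>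
    obtain rfl : k = b := by simp at h1 h2; omega
    -- The program point stored in the load is the one where its group begins, so fetching resumes
    -- on the same path.
    have : p = pc := by
      rw [hg] at hgb
      subst hgb
      cases I <;> simp_all [Instr.simple]
    exact this ▸ h.truncate hb hk.le
  | br hI hgb =>
    obtain rfl : k = b := by simp at h1 h2; omega
    simp [hg] at hgb
  | jmpi hI hgb =>
    obtain rfl : k = b := by simp at h1 h2; omega
    simp [hg] at hgb
  | call hI hg0 hg1 hg2 =>
    have : k = b ∨ k = b + 1 ∨ k = b + 2 := by simp at h1 h2; omega
    rcases this with rfl | rfl | rfl <;> simp_all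
  | ret hI hg0 hg1 hg2 hg3 =>
    have : k = b ∨ k = b + 1 ∨ k = b + 2 ∨ k = b + 3 := by simp at h1 h2; omega
    rcases this with rfl | rfl | rfl | rfl
    · simp_all
    · rw [hg1] at hg
      cases hg
      -- The load of a return is not at a group boundary: its `ret` marker survives the cut, while
      -- fetching resumes at the return itself.
      exact h.truncate (Relation.ReflTransGen.tail hb (.orphan hI hg0)) hk.le
    · simp_all
    · simp_all
  | orphan hI hgb =>
    obtain rfl : k = b := by simp at h1 h2; omega
    simp [hg] at hgb

theorem truncate_loadFwd (h : Inv M P ρ μ n buf i₀ p₀ e g) {k : ℕ} {r args v j pc}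
    (hb : buf k = some (.loadFwd r args v j pc)) :
    Inv M P ρ μ pc (before buf k) i₀ p₀ k g := by
  obtain ⟨h1, h2⟩ := h.range' hb
  have ht := h.tracks' hb
  generalize hg : g k = t at ht
  cases ht with
  | refl h => exact h.elim
  | loadFwd => exact h.truncate_load h1 h2 hg

theorem truncate_hazard (h : Inv M P ρ μ n buf i₀ p₀ e g) {k i : ℕ} {t a pc}
    (hb : buf k = some t) (hz : t.Hazard i a pc) :
    Inv M P ρ μ pc (before buf k) i₀ p₀ k g := by
  obtain ⟨h1, h2⟩ := h.range' hb
  have ht := h.tracks' hb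
  generalize hg : g k = t' at ht
  cases hz <;> cases ht with
  | refl h => exact h.elim
  | loadVal => exact h.truncate_load h1 h2 hg

theorem of_br (h : Inv M P ρ μ n buf i₀ p₀ e g) {i f args n₀ nt nf}
    (hb : buf i = some (.br f args n₀ nt nf)) : g i = .br f args n₀ nt nf := by
  have ht := h.tracks' hb
  generalize g i = t at ht
  cases ht; rfl

theorem of_op (h : Inv M P ρ μ n buf i₀ p₀ e g) {i f r args}
    (hb : buf i = some (.op f r args)) : g i = .op f r args := by
  have ht := h.tracks' hb
  generalize g i = t at ht
  cases ht; rfl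

theorem of_load (h : Inv M P ρ μ n buf i₀ p₀ e g) {i r args pc}
    (hb : buf i = some (.load r args pc)) : g i = .load r args pc := by
  have ht := h.tracks' hb
  generalize g i = t at ht
  cases ht; rfl

theorem of_loadFwd (h : Inv M P ρ μ n buf i₀ p₀ e g) {i r args v j pc}
    (hb : buf i = some (.loadFwd r args v j pc)) : g i = .load r args pc := by
  have ht := h.tracks' hb
  generalize g i = t at ht
  cases ht with
  | refl h => exact h.elim
  | loadFwd => rfl

theorem of_jmpi (h : Inv M P ρ μ n buf i₀ p₀ e g) {i args n₀}
    (hb : buf i = some (.jmpi args n₀)) : g i = .jmpi args n₀ := by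
  have ht := h.tracks' hb
  generalize g i = t at ht
  cases ht; rfl

/-- Correcting the last entry of a group and deleting all later entries. -/
theorem redirect (h : Inv M P ρ μ n buf i₀ p₀ e g) {i b : ℕ} {p n' : V}
    {t' u' : Trans V L R F B} (hi : i < e) (hbi : b ≤ i) (hc : Chain M P g (i₀, p₀) (b, p))
    (hG : Group M P (Function.update g i t') (b, p) (i + 1, n'))
    (ht : Tracks M buf ρ μ i t' u') :
    Inv M P ρ μ n' (Speculative.insert (before buf i) i u') i₀ p₀ (i + 1)
      (Function.update g i t') := by
  have hagree : ∀ j < i, Speculative.insert (before buf i) i u' j = buf j := fun j hj => by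
    simp [Speculative.insert, before, hj, hj.ne]
  have hi₀ : i₀ ≤ b := Chain.le hc
  have hdom : ∀ j, i₀ ≤ j → j ≤ i → buf j ≠ none := fun j h1 h2 => by
    obtain ⟨u, hu, -⟩ := h.tracks j h1 (by omega)
    simp [hu]
  refine (h.truncate hc (by omega)).append hG (fun j hj => ?_) (fun j hj => ?_)
    (fun j hj => ?_) (fun j h1 h2 => ?_)
  · exact Function.update_of_ne (by omega) _ _
  · rw [hagree j (by omega)]
    simp [before, hj]
  · simp [Speculative.insert, before, show j ≠ i by omega, show ¬ j < i by omega]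
  · rcases (show j ≤ i by omega).eq_or_lt with rfl | hji
    · exact ⟨u', by simp [Speculative.insert], by
        simpa using ht.congr (hdom j (by omega) le_rfl) hagree⟩
    · obtain ⟨u, h3, h4⟩ := h.tracks j (by omega) (by omega)
      refine ⟨u, by rw [hagree j hji, h3], ?_⟩
      rw [Function.update_of_ne hji.ne]
      exact h4.congr (by simp [h3]) fun k hk => hagree k (hk.trans hji)

/-- A branch is the only entry of its group, so replacing the guess by the computed outcome leaves a
valid group ending at `n'`. -/
theorem redirect_br (h : Inv M P ρ μ n buf i₀ p₀ e g) {i f args n₀ nt nf vs n'}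
    (hb : buf i = some (.br f args n₀ nt nf)) (hv : resolveAll buf ρ i args = some vs)
    (hn : cond (M.evalCond f (vals vs)) nt nf = n') :
    ∃ g', Inv M P ρ μ n' (Speculative.insert (before buf i) i (.jump n')) i₀ p₀ (i + 1) g' := by
  have hg := h.of_br hb
  obtain ⟨h1, h2⟩ := h.range' hb
  obtain ⟨⟨b, p⟩, c, hc, hG, h3, h4, -⟩ := Chain.exists_group h.chain h1 h2
  refine ⟨_, h.redirect (t' := .br f args n' nt nf) h2 h3 hc ?_ (.br hv hn)⟩
  cases hG with
  | @simple _ _ I t n hI ht hgb =>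
    obtain rfl : i = b := by simp at h3 h4; omega
    rw [hg] at hgb
    subst hgb
    cases I <;> simp_all [Instr.simple]
  | br hI hgb =>
    obtain rfl : i = b := by simp at h3 h4; omega
    rw [hg] at hgb
    cases hgb
    exact .br hI (by simp)
  | jmpi hI hgb =>
    obtain rfl : i = b := by simp at h3 h4; omega
    simp [hg] at hgb
  | call hI hg0 hg1 hg2 =>
    have : i = b ∨ i = b + 1 ∨ i = b + 2 := by simp at h3 h4; omega
    rcases this with rfl | rfl | rfl <;> simp_all
  | ret hI hg0 hg1 hg2 hg3 =>
    have : i = b ∨ i = b + 1 ∨ i = b + 2 ∨ i = b + 3 := by simp at h3 h4; omega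
    rcases this with rfl | rfl | rfl | rfl <;> simp_all
  | orphan hI hgb =>
    obtain rfl : i = b := by simp at h3 h4; omega
    simp [hg] at hgb

/-- An indirect jump is the last entry of its group, whether it forms an instruction by itself or
closes a return, so no part of the group is lost behind it. -/
theorem redirect_jmpi (h : Inv M P ρ μ n buf i₀ p₀ e g) {i args n₀ vs n'}
    (hb : buf i = some (.jmpi args n₀)) (hv : resolveAll buf ρ i args = some vs)
    (hn : M.addr (vals vs) = n') :
    ∃ g', Inv M P ρ μ n' (Speculative.insert (before buf i) i (.jump n')) i₀ p₀ (i + 1) g' := by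
  have hg := h.of_jmpi hb
  obtain ⟨h1, h2⟩ := h.range' hb
  obtain ⟨⟨b, p⟩, c, hc, hG, h3, h4, -⟩ := Chain.exists_group h.chain h1 h2
  refine ⟨_, h.redirect (t' := .jmpi args n') h2 h3 hc ?_ (.jmpi hv hn)⟩
  cases hG with
  | @simple _ _ I t n hI ht hgb =>
    obtain rfl : i = b := by simp at h3 h4; omega
    rw [hg] at hgb
    subst hgb
    cases I <;> simp_all [Instr.simple]
  | br hI hgb =>
    obtain rfl : i = b := by simp at h3 h4; omega
    simp [hg] at hgb
  | jmpi hI hgb =>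
    obtain rfl : i = b := by simp at h3 h4; omega
    rw [hg] at hgb
    cases hgb
    exact .jmpi hI (by simp)
  | call hI hg0 hg1 hg2 =>
    have : i = b ∨ i = b + 1 ∨ i = b + 2 := by simp at h3 h4; omega
    rcases this with rfl | rfl | rfl <;> simp_all
  | ret hI hg0 hg1 hg2 hg3 =>
    have : i = b ∨ i = b + 1 ∨ i = b + 2 ∨ i = b + 3 := by simp at h3 h4; omega
    rcases this with rfl | rfl | rfl | rfl
    · simp_all
    · simp_all
    · simp_all
    · rw [hg] at hg3
      cases hg3
      exact .ret hI (by simpa using hg0) (by simpa using hg1) (by simpa using hg2) (by simp)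
  | orphan hI hgb =>
    obtain rfl : i = b := by simp at h3 h4; omega
    simp [hg] at hgb

/-- Fetching an instruction with a single entry. -/
theorem fetch_one (h : Inv M P ρ μ n buf i₀ p₀ (fresh buf) g) {t : Trans V L R F B} {n' : V}
    (hG : Group M P (Function.update g (fresh buf) t) (fresh buf, n) (fresh buf + 1, n'))
    (ht : Tracks M (Speculative.insert buf (fresh buf) t) ρ μ (fresh buf) t t) :
    ∃ e g', Inv M P ρ μ n' (Speculative.insert buf (fresh buf) t) i₀ p₀ e g' := by
  refine ⟨_, _, h.append hG (fun j hj => Function.update_of_ne hj.ne _ _)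
    (fun j hj => by simp [Speculative.insert, hj.ne]) (fun j hj => ?_) (fun j h1 h2 => ?_)⟩
  · have : j ≠ fresh buf := by omega
    by_contra hne
    have := h.range j (by simpa [Speculative.insert, this] using hne)
    omega
  · obtain rfl : j = fresh buf := by omega
    exact ⟨t, by simp [Speculative.insert], by simpa using ht⟩

theorem fetch_call (h : Inv M P ρ μ n buf i₀ p₀ (fresh buf) g) {nf nr : V} {i : ℕ}
    (hI : P n = some (.call nf nr)) (hi : i = fresh buf) :
    ∃ e g', Inv M P ρ μ nf (Speculative.insert (Speculative.insert (Speculative.insert buf i .call)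
      (i + 1) (.op M.succ M.rsp [.reg M.rsp]))
      (i + 2) (.store (.val (nr, ⊥)) (.pending [.reg M.rsp]))) i₀ p₀ e g' := by
  subst hi
  set i := fresh buf
  refine ⟨i + 3, Function.update (Function.update (Function.update g i .call)
    (i + 1) (.op M.succ M.rsp [.reg M.rsp]))
    (i + 2) (.store (.val (nr, ⊥)) (.pending [.reg M.rsp])),
    h.append (.call hI (by simp) (by simp) (by simp)) (fun j hj => ?_) (fun j hj => ?_)
      (fun j hj => ?_) (fun j h1 h2 => ?_)⟩
  · simp [show j ≠ i by omega, show j ≠ i + 1 by omega,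
      show j ≠ i + 2 by omega]
  · simp [Speculative.insert, show j ≠ i by omega, show j ≠ i + 1 by omega,
      show j ≠ i + 2 by omega]
  · simp only [Speculative.insert, Function.update_apply, show j ≠ i by omega,
      show j ≠ i + 1 by omega, show j ≠ i + 2 by omega, if_false]
    by_contra hne
    have := h.range j hne
    omega
  · have : j = i ∨ j = i + 1 ∨ j = i + 2 := by omega
    rcases this with rfl | rfl | rfl
    · exact ⟨.call, by simp [Speculative.insert], by simpa using .refl trivial⟩
    · exact ⟨.op M.succ M.rsp [.reg M.rsp], by simp [Speculative.insert],
        by simpa using .refl trivial⟩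
    · exact ⟨.store (.val (nr, ⊥)) (.pending [.reg M.rsp]), by simp [Speculative.insert],
        by simpa using .store (.inl rfl) (.inl rfl)⟩

theorem fetch_ret (h : Inv M P ρ μ n buf i₀ p₀ (fresh buf) g) {n' : V} {i : ℕ}
    (hI : P n = some .ret) (hi : i = fresh buf) :
    ∃ e g', Inv M P ρ μ n' (retEntries M buf i n n') i₀ p₀ e g' := by
  subst hi
  set i := fresh buf
  refine ⟨i + 4, Function.update (Function.update (Function.update (Function.update g i .ret)
    (i + 1) (.load M.rret [.reg M.rsp] n)) (i + 2) (.op M.pred M.rsp [.reg M.rsp]))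
    (i + 3) (.jmpi [.reg M.rret] n'),
    h.append (.ret hI (by simp) (by simp) (by simp) (by simp)) (fun j hj => ?_) (fun j hj => ?_)
      (fun j hj => ?_) (fun j h1 h2 => ?_)⟩
  · simp [show j ≠ i by omega, show j ≠ i + 1 by omega,
      show j ≠ i + 2 by omega, show j ≠ i + 3 by omega]
  · simp [retEntries, Speculative.insert, show j ≠ i by omega,
      show j ≠ i + 1 by omega, show j ≠ i + 2 by omega, show j ≠ i + 3 by omega]
  · simp only [retEntries, Speculative.insert, Function.update_apply, show j ≠ i by omega,
      show j ≠ i + 1 by omega, show j ≠ i + 2 by omega, show j ≠ i + 3 by omega, if_false]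
    by_contra hne
    have := h.range j hne
    omega
  · have : j = i ∨ j = i + 1 ∨ j = i + 2 ∨ j = i + 3 := by omega
    rcases this with rfl | rfl | rfl | rfl
    · exact ⟨.ret, by simp [retEntries, Speculative.insert], by simpa using .refl trivial⟩
    · exact ⟨.load M.rret [.reg M.rsp] n, by simp [retEntries, Speculative.insert],
        by simpa using .refl trivial⟩
    · exact ⟨.op M.pred M.rsp [.reg M.rsp], by simp [retEntries, Speculative.insert],
        by simpa using .refl trivial⟩
    · exact ⟨.jmpi [.reg M.rret] n', by simp [retEntries, Speculative.insert],
        by simpa using .refl trivial⟩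

end Inv

end Preservation

/-! ### Retirement of the oldest group as one in-order step. -/

section Retire

variable {V L R F B : Type*} [DecidableEq V] [DecidableEq R] [Lattice L] [OrderBot L]

section Group

variable {M : Machine V R F B} {P : Program V L R F B} {g : ℕ → Trans V L R F B}
  {i m : ℕ} {p q : V}

/-- Together with the similar lemmas below, this recovers the program's instruction from the first
fetched entry of a group. Operations and stores inside a call or return cannot interfere, since
those groups begin with a marker. -/
theorem Group.of_op (h : Group M P g (i, p) (m, q)) {f r args} (hg : g i = .op f r args) :
    P p = some (.op f r args q) ∧ m = i + 1 := by
  cases h with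
  | @simple _ _ I =>
    cases I <;> simp_all [Instr.simple]
  | _ => simp_all

theorem Group.of_load (h : Group M P g (i, p) (m, q)) {r args pc} (hg : g i = .load r args pc) :
    P p = some (.load r args q) ∧ m = i + 1 := by
  cases h with
  | @simple _ _ I =>
    cases I <;> simp_all [Instr.simple]
  | _ => simp_all

theorem Group.of_store (h : Group M P g (i, p) (m, q)) {src args}
    (hg : g i = .store src (.pending args)) : P p = some (.store src args q) ∧ m = i + 1 := by
  cases h with
  | @simple _ _ I =>
    cases I <;> simp_all [Instr.simple]
  | _ => simp_all

theorem Group.of_fence (h : Group M P g (i, p) (m, q)) (hg : g i = .fence) :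
    P p = some (.fence q) ∧ m = i + 1 := by
  cases h with
  | @simple _ _ I =>
    cases I <;> simp_all [Instr.simple]
  | _ => simp_all

theorem Group.of_br (h : Group M P g (i, p) (m, q)) {f args n nt nf}
    (hg : g i = .br f args n nt nf) : P p = some (.br f args nt nf) ∧ q = n ∧ m = i + 1 := by
  cases h with
  | @simple _ _ I =>
    cases I <;> simp_all [Instr.simple]
  | _ => simp_all

theorem Group.of_jmpi (h : Group M P g (i, p) (m, q)) {args n}
    (hg : g i = .jmpi args n) : P p = some (.jmpi args) ∧ q = n ∧ m = i + 1 := by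
  cases h with
  | @simple _ _ I =>
    cases I <;> simp_all [Instr.simple]
  | _ => simp_all

theorem Group.of_call (h : Group M P g (i, p) (m, q)) (hg : g i = .call) :
    ∃ nr, P p = some (.call q nr) ∧ m = i + 3 ∧
      g (i + 1) = .op M.succ M.rsp [.reg M.rsp] ∧
      g (i + 2) = .store (.val (nr, ⊥)) (.pending [.reg M.rsp]) := by
  cases h with
  | @simple _ _ I =>
    cases I <;> simp_all [Instr.simple]
  | _ => simp_all

theorem Group.of_ret (h : Group M P g (i, p) (m, q)) (hg : g i = .ret) :
    P p = some .ret ∧ ((m = i + 4 ∧ g (i + 1) = .load M.rret [.reg M.rsp] p ∧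
      g (i + 2) = .op M.pred M.rsp [.reg M.rsp] ∧ g (i + 3) = .jmpi [.reg M.rret] q) ∨
      (m = i + 1 ∧ q = p)) := by
  cases h with
  | @simple _ _ I =>
    cases I <;> simp_all [Instr.simple]
  | _ => simp_all

/-- Used behind an orphaned marker: fetching resumed at the same return, so the next group begins
with `ret` too. -/
theorem Group.eq_ret (h : Group M P g (i, p) (m, q)) (hp : P p = some .ret) : g i = .ret := by
  cases h with
  | @simple _ _ I =>
    cases I <;> simp_all [Instr.simple]
  | _ => simp_all

end Group

namespace Inv

variable {M : Machine V R F B} {P : Program V L R F B} {ρ : R → Option (V × L)}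
  {μ : V → Option (V × L)} {n : V} {buf : Buf V L R F B} {i₀ : ℕ} {p₀ : V} {e : ℕ}
  {g : ℕ → Trans V L R F B}

theorem erase_eq (h : Inv M P ρ μ n buf i₀ p₀ e g) {j : ℕ} (hj : j < i₀ + 1) :
    erase buf i₀ j = none := by
  by_cases hji : j = i₀
  · simp [erase, hji]
  · simpa [erase, hji] using h.none_of_lt (by omega)

/-- The oldest entry has nothing before it, so it sees exactly the committed registers, as
`ArchStep` requires. -/
theorem resolveReg_front (h : Inv M P ρ μ n buf i₀ p₀ e g) (r : R) :
    resolveReg buf ρ i₀ r = ρ r :=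
  resolveReg_of_none (fun _ hj => h.none_of_lt hj) r

theorem resolveAll_front (h : Inv M P ρ μ n buf i₀ p₀ e g) (args : List (Operand V L R)) :
    resolveAll buf ρ i₀ args = resolveAll (fun _ => none : Buf V L R F B) ρ 0 args :=
  resolveAll_of_none (fun _ hj => h.none_of_lt hj) args

theorem resolve_front (h : Inv M P ρ μ n buf i₀ p₀ e g) (o : Operand V L R) :
    resolve buf ρ i₀ o = resolve (fun _ => none : Buf V L R F B) ρ 0 o := by
  rw [resolve_of_none fun _ hj => h.none_of_lt hj]

/-- Retiring a single entry that is not a store. -/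
theorem drop_one (hP : ∀ n I, P n = some I → Operand.reg M.rret ∉ I.operands)
    (h : Inv M P ρ μ n buf i₀ p₀ e g) {p₁ : V} {t : Trans V L R F B}
    (hG : Group M P g (i₀, p₀) (i₀ + 1, p₁)) (hc : Chain M P g (i₀ + 1, p₁) (e, n))
    (hb : buf i₀ = some t) (ht : ∀ src sa, t ≠ .store src sa) {ρ' : R → Option (V × L)}
    (hρ : ∀ r, ρ' r = if t.dest = some r then t.value else ρ r) :
    Inv M P ρ' μ n (erase buf i₀) (i₀ + 1) p₁ e g := by
  have hge : ∀ j, i₀ + 1 ≤ j → erase buf i₀ j = buf j := fun j hj => by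
    simp [erase, show j ≠ i₀ by omega]
  refine h.drop hP hG hc hge (fun j hj => h.erase_eq hj) (fun r _ => ?_)
    fun k a v dep _ hd => hd.drop hge (fun j hj => h.erase_eq hj) fun j hj src sa hs => ?_
  · rw [resolveReg_succ hb, hρ, h.resolveReg_front]
  · have := h.range' hs
    obtain rfl : j = i₀ := by omega
    rw [hb, Option.some.injEq] at hs
    exact ht _ _ hs

theorem first_group (h : Inv M P ρ μ n buf i₀ p₀ e g) (hlt : i₀ < e) :
    ∃ m q, Group M P g (i₀, p₀) (m, q) ∧ Chain M P g (m, q) (e, n) := by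
  rcases Relation.ReflTransGen.cases_head h.chain with h1 | ⟨⟨m, q⟩, h1, h2⟩
  · cases h1; omega
  · exact ⟨m, q, h1, h2⟩

theorem retire_value (hP : ∀ n I, P n = some I → Operand.reg M.rret ∉ I.operands)
    (h : Inv M P ρ μ n buf i₀ p₀ e g) {t r v} (hb : buf i₀ = some t) (ht : t.IsVal r v) :
    ∃ p₁, ArchStep M P (ρ, μ, p₀) (Function.update ρ r (some v), μ, p₁) ∧
      Inv M P (Function.update ρ r (some v)) μ n (erase buf i₀) (i₀ + 1) p₁ e g := by
  obtain ⟨m, q, hG, hc⟩ := h.first_group (h.range' hb).2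
  have hT := h.tracks' hb
  generalize hg : g i₀ = t' at hT
  refine ⟨q, ?_⟩
  cases ht with
  | val =>
    cases hT with
    | refl h => exact h.elim
    | op hv =>
      obtain ⟨hp, rfl⟩ := hG.of_op hg
      refine ⟨.op hp (by rw [← h.resolveAll_front, hv]), h.drop_one hP hG hc hb (by simp) ?_⟩
      intro r'
      simp [Function.update_apply, Trans.dest, Trans.value, eq_comm]
  | loadVal =>
    cases hT with
    | refl h => exact h.elim
    | loadVal hv ha hd =>
      obtain ⟨hp, rfl⟩ := hG.of_load hg
      refine ⟨.load hp (by rw [← h.resolveAll_front, hv]) ?_, h.drop_one hP hG hc hb (by simp) ?_⟩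
      · rw [ha]
        exact hd.mem_eq fun j hj src sa => by simp [h.none_of_lt hj]
      · intro r'
        simp [Function.update_apply, Trans.dest, Trans.value, eq_comm]

/-- A jump is tracked as resolved only when its recorded guess equals the computed target, so the
next group starts at the true successor. -/
theorem retire_jump (hP : ∀ n I, P n = some I → Operand.reg M.rret ∉ I.operands)
    (h : Inv M P ρ μ n buf i₀ p₀ e g) {n₀} (hb : buf i₀ = some (.jump n₀)) :
    ∃ p₁, ArchStep M P (ρ, μ, p₀) (ρ, μ, p₁) ∧
      Inv M P ρ μ n (erase buf i₀) (i₀ + 1) p₁ e g := by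
  obtain ⟨m, q, hG, hc⟩ := h.first_group (h.range' hb).2
  have hT := h.tracks' hb
  generalize hg : g i₀ = t' at hT
  refine ⟨q, ?_⟩
  cases hT with
  | refl h => exact h.elim
  | br hv hn =>
    obtain ⟨hp, rfl, rfl⟩ := hG.of_br hg
    exact ⟨hn ▸ .br hp (by rw [← h.resolveAll_front, hv]),
      h.drop_one hP hG hc hb (by simp) (by simp [Trans.dest])⟩
  | jmpi hv hn =>
    obtain ⟨hp, rfl, rfl⟩ := hG.of_jmpi hg
    exact ⟨hn ▸ .jmpi hp (by rw [← h.resolveAll_front, hv]),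
      h.drop_one hP hG hc hb (by simp) (by simp [Trans.dest])⟩

theorem retire_fence (hP : ∀ n I, P n = some I → Operand.reg M.rret ∉ I.operands)
    (h : Inv M P ρ μ n buf i₀ p₀ e g) (hb : buf i₀ = some .fence) :
    ∃ p₁, ArchStep M P (ρ, μ, p₀) (ρ, μ, p₁) ∧
      Inv M P ρ μ n (erase buf i₀) (i₀ + 1) p₁ e g := by
  obtain ⟨m, q, hG, hc⟩ := h.first_group (h.range' hb).2
  have hT := h.tracks' hb
  generalize hg : g i₀ = t' at hT
  cases hT with
  | refl h' =>
    obtain ⟨hp, rfl⟩ := hG.of_fence hg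
    exact ⟨q, .fence hp, h.drop_one hP hG hc hb (by simp) (by simp [Trans.dest])⟩

theorem retire_store (hP : ∀ n I, P n = some I → Operand.reg M.rret ∉ I.operands)
    (h : Inv M P ρ μ n buf i₀ p₀ e g) {v a l}
    (hb : buf i₀ = some (.store (.val v) (.resolved (a, l)))) :
    ∃ p₁, ArchStep M P (ρ, μ, p₀) (ρ, Function.update μ a (some v), p₁) ∧
      Inv M P ρ (Function.update μ a (some v)) n (erase buf i₀) (i₀ + 1) p₁ e g := by
  obtain ⟨m, q, hG, hc⟩ := h.first_group (h.range' hb).2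
  have hT := h.tracks' hb
  generalize hg : g i₀ = t' at hT
  refine ⟨q, ?_⟩
  cases hT with
  | refl h => exact h.elim
  | @store src args _ _ hs hv =>
    obtain ⟨hp, rfl⟩ := hG.of_store hg
    obtain ⟨vs, hv, ha⟩ := hv.resolve_left (by simp)
    simp only [StoreAddr.resolved.injEq, Prod.mk.injEq] at ha
    -- A source that was a constant from the start resolves to itself.
    have hs' : resolve buf ρ i₀ src = some v := by
      rcases hs with rfl | ⟨w, hw, hs⟩
      · rfl
      · cases hw; exact hs
    have hge : ∀ j, i₀ + 1 ≤ j → erase buf i₀ j = buf j := fun j hj => by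
      simp [erase, show j ≠ i₀ by omega]
    refine ⟨ha.1 ▸ .store hp (by rw [← h.resolve_front, hs']) (by rw [← h.resolveAll_front, hv]),
      h.drop hP hG hc hge (fun j hj => h.erase_eq hj) (fun r _ => ?_)
      fun k a v dep hk hd => hd.drop_store hk hge (fun j hj => h.erase_eq (by omega))
        (fun j hj src sa => by simp [h.none_of_lt hj]) hb⟩
    rw [resolveReg_succ hb, h.resolveReg_front]
    simp [Trans.dest]

theorem retire_call (hP : ∀ n I, P n = some I → Operand.reg M.rret ∉ I.operands)
    (h : Inv M P ρ μ n buf i₀ p₀ e g) {t₁ vsp v a l} (hb : buf i₀ = some .call)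
    (hb₁ : buf (i₀ + 1) = some t₁) (ht₁ : t₁.IsVal M.rsp vsp)
    (hb₂ : buf (i₀ + 2) = some (.store (.val v) (.resolved (a, l)))) :
    ∃ p₁, ArchStep M P (ρ, μ, p₀)
        (Function.update ρ M.rsp (some vsp), Function.update μ a (some v), p₁) ∧
      Inv M P (Function.update ρ M.rsp (some vsp)) (Function.update μ a (some v)) n
        (after buf (i₀ + 2)) (i₀ + 3) p₁ e g := by
  obtain ⟨m, q, hG, hc⟩ := h.first_group (h.range' hb).2
  have hT := h.tracks' hb
  have hT₁ := h.tracks' hb₁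
  have hT₂ := h.tracks' hb₂
  have hg : g i₀ = .call := by
    generalize g i₀ = t' at hT
    cases hT; rfl
  obtain ⟨nr, hp, rfl, hg₁, hg₂⟩ := hG.of_call hg
  rw [hg₁] at hT₁
  rw [hg₂] at hT₂
  cases ht₁ with
  | loadVal => cases hT₁
  | val =>
  cases hT₁ with
  | @op _ _ _ vs hv =>
  cases hT₂ with
  | store hs hv' =>
  obtain ⟨ws, hv', ha⟩ := hv'.resolve_left (by simp)
  simp only [StoreAddr.resolved.injEq, Prod.mk.injEq] at ha
  obtain rfl : v = (nr, ⊥) := by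
    rcases hs with hs | ⟨w, hw, hs⟩
    · cases hs; rfl
    · cases hw; cases hs; rfl
  have hr₁ : ∀ r, resolveReg buf ρ (i₀ + 1) r = ρ r := fun r => by
    rw [resolveReg_succ hb, h.resolveReg_front]
    simp [Trans.dest]
  -- The store of a call sees the already moved stack pointer, so the return point is written at the
  -- new top of the stack.
  have hr₂ : ∀ r, resolveReg buf ρ (i₀ + 2) r =
      Function.update ρ M.rsp (some (M.evalOp M.succ (vals vs), lub vs)) r := fun r => by
    rw [resolveReg_succ hb₁, hr₁]
    simp [Trans.dest, Trans.value, Function.update_apply, eq_comm]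
  simp only [resolveAll, List.mapM_cons, resolve, hr₁, List.mapM_nil, Option.pure_def,
    Option.bind_eq_bind, Option.bind_eq_some_iff, Option.some.injEq] at hv
  obtain ⟨w, hw, _, rfl, rfl⟩ := hv
  simp only [resolveAll, List.mapM_cons, resolve, hr₂, List.mapM_nil, Option.pure_def,
    Option.bind_eq_bind, Option.bind_eq_some_iff, Option.some.injEq, Function.update_self] at hv'
  obtain ⟨_, rfl, _, rfl, rfl⟩ := hv'
  have hge : ∀ j, i₀ + 3 ≤ j → after buf (i₀ + 2) j = buf j := fun j hj => by
    simp [after, show i₀ + 2 < j by omega]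
  have hlt : ∀ j < i₀ + 3, after buf (i₀ + 2) j = none := fun j hj => by
    simp [after, show ¬ i₀ + 2 < j by omega]
  refine ⟨q, ha.1 ▸ .call hp hw, h.drop hP hG hc hge hlt (fun r _ => ?_)
    fun k a v dep hk hd => hd.drop_store hk hge (fun j hj => hlt j (by omega)) ?_ hb₂⟩
  · rw [resolveReg_succ hb₂, hr₂]
    simp [Trans.dest]
  · intro j hj src sa hst
    have : j < i₀ ∨ j = i₀ ∨ j = i₀ + 1 := by omega
    rcases this with hj | rfl | rfl
    · simp [h.none_of_lt hj] at hst
    · cases hb.symm.trans hst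
    · cases hb₁.symm.trans hst

theorem retire_ret (hP : ∀ n I, P n = some I → Operand.reg M.rret ∉ I.operands)
    (h : Inv M P ρ μ n buf i₀ p₀ e g) {t₁ v₁ t₂ v₂ n'} (hb : buf i₀ = some .ret)
    (hb₁ : buf (i₀ + 1) = some t₁) (ht₁ : t₁.IsVal M.rret v₁)
    (hb₂ : buf (i₀ + 2) = some t₂) (ht₂ : t₂.IsVal M.rsp v₂)
    (hb₃ : buf (i₀ + 3) = some (.jump n')) :
    ∃ p₁, ArchStep M P (ρ, μ, p₀) (Function.update ρ M.rsp (some v₂), μ, p₁) ∧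
      Inv M P (Function.update ρ M.rsp (some v₂)) μ n (after buf (i₀ + 3)) (i₀ + 4) p₁ e g := by
  obtain ⟨m, q, hG, hc⟩ := h.first_group (h.range' hb).2
  have hT := h.tracks' hb
  have hT₁ := h.tracks' hb₁
  have hT₂ := h.tracks' hb₂
  have hT₃ := h.tracks' hb₃
  have hg : g i₀ = .ret := by
    generalize g i₀ = t' at hT
    cases hT; rfl
  obtain ⟨hp, ⟨rfl, hg₁, hg₂, hg₃⟩ | ⟨rfl, rfl⟩⟩ := hG.of_ret hg
  swap
  -- An orphaned marker can never retire: either nothing follows it, or the next entry is another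
  -- `ret`, whereas retiring needs a resolved assignment there.
  · rcases Relation.ReflTransGen.cases_head hc with h1 | ⟨⟨m', q'⟩, h1, -⟩
    · have := (h.range' hb₁).2
      cases h1
      omega
    · rw [h1.eq_ret hp] at hT₁
      cases ht₁ <;> cases hT₁
  rw [hg₁] at hT₁
  rw [hg₂] at hT₂
  rw [hg₃] at hT₃
  cases ht₁ with
  | val => cases hT₁
  | loadVal =>
  cases hT₁ with
  | @loadVal _ _ _ _ _ _ vs hv ha hd =>
  cases ht₂ with
  | loadVal => cases hT₂
  | val =>
  cases hT₂ with
  | @op _ _ _ ws hv' =>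
  cases hT₃ with
  | jmpi hv'' hn =>
  have hr₁ : ∀ r, resolveReg buf ρ (i₀ + 1) r = ρ r := fun r => by
    rw [resolveReg_succ hb, h.resolveReg_front]
    simp [Trans.dest]
  have hr₂ : ∀ r, resolveReg buf ρ (i₀ + 2) r = if M.rret = r then some v₁ else ρ r := fun r => by
    rw [resolveReg_succ hb₁, hr₁]
    simp [Trans.dest, Trans.value]
  have hr₃ : ∀ r, resolveReg buf ρ (i₀ + 3) r = if M.rsp = r then
      some (M.evalOp M.pred (vals ws), lub ws) else if M.rret = r then some v₁ else ρ r :=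
    fun r => by
      rw [resolveReg_succ hb₂, hr₂]
      simp [Trans.dest, Trans.value]
  simp only [resolveAll, List.mapM_cons, resolve, hr₁, List.mapM_nil, Option.pure_def,
    Option.bind_eq_bind, Option.bind_eq_some_iff, Option.some.injEq] at hv
  obtain ⟨w, hw, _, rfl, rfl⟩ := hv
  simp only [resolveAll, List.mapM_cons, resolve, hr₂, List.mapM_nil, Option.pure_def,
    Option.bind_eq_bind, Option.bind_eq_some_iff, Option.some.injEq, M.rsp_ne_rret.symm,
    if_false] at hv'
  obtain ⟨w', hw', _, rfl, rfl⟩ := hv'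
  -- The load assigns only the return register, so the load and the later decrement read the same
  -- stack pointer.
  obtain rfl : w = w' := by simpa [hw] using hw'
  simp only [resolveAll, List.mapM_cons, resolve, hr₃, List.mapM_nil, Option.pure_def,
    Option.bind_eq_bind, Option.bind_eq_some_iff, Option.some.injEq, M.rsp_ne_rret,
    if_false, if_true] at hv''
  obtain ⟨_, rfl, _, rfl, rfl⟩ := hv''
  have hge : ∀ j, i₀ + 4 ≤ j → after buf (i₀ + 3) j = buf j := fun j hj => by
    simp [after, show i₀ + 3 < j by omega]
  have hlt : ∀ j < i₀ + 4, after buf (i₀ + 3) j = none := fun j hj => by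
    simp [after, show ¬ i₀ + 3 < j by omega]
  have hns : ∀ j < i₀ + 4, ∀ src sa, buf j ≠ some (.store src sa) := by
    intro j hj src sa hs
    have : j < i₀ ∨ j = i₀ ∨ j = i₀ + 1 ∨ j = i₀ + 2 ∨ j = i₀ + 3 := by omega
    rcases this with hj | rfl | rfl | rfl | rfl
    · simp [h.none_of_lt hj] at hs
    · cases hb.symm.trans hs
    · cases hb₁.symm.trans hs
    · cases hb₂.symm.trans hs
    · cases hb₃.symm.trans hs
  refine ⟨_, .ret hp hw ?_, hn.symm ▸ h.drop hP hG hc hge hlt (fun r hr => ?_)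
    fun k a v dep hk hd => hd.drop hge hlt hns⟩
  · rw [ha]
    exact hd.mem_eq fun j hj => hns j (by omega)
  -- The committed map agrees with the buffer on all registers except the return register, which
  -- `Inv.drop` leaves out.
  · rw [resolveReg_succ hb₃, hr₃]
    simp [Trans.dest, Function.update_apply, hr.symm, eq_comm]

end Inv

end Retire

/-! ### Simulation of executions by the in-order machine. -/

section Simulation

variable {V L R F B : Type*} [DecidableEq V] [DecidableEq R] [Lattice L] [OrderBot L]

/-- The state `S` speculates ahead of the architectural state `a`. -/
def Ahead (M : Machine V R F B) (P : Program V L R F B)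
    (a : (R → Option (V × L)) × (V → Option (V × L)) × V) (S : State V L R F B) : Prop :=
  S.cfg.reg = a.1 ∧ S.cfg.mem = a.2.1 ∧
    ∃ i₀ e g, Inv M P S.cfg.reg S.cfg.mem S.cfg.pc S.cfg.buf i₀ a.2.2 e g

theorem Ahead.of_terminal {M : Machine V R F B} {P : Program V L R F B} {C : Config V L R F B}
    (hC : C.Terminal) (σ : Rsb V) : Ahead M P (C.reg, C.mem, C.pc) ⟨C, σ⟩ :=
  ⟨rfl, rfl, 0, 0, fun _ => .fence, Inv.of_none hC 0⟩

/-- The entries of a call or a return leave together, so one `retire` commits one whole instruction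
and the two counts agree. -/
theorem Ahead.retire {M : Machine V R F B} {P : Program V L R F B}
    (hP : ∀ n I, P n = some I → Operand.reg M.rret ∉ I.operands)
    {a : (R → Option (V × L)) × (V → Option (V × L)) × V} {S S' : State V L R F B} {o}
    (h : Ahead M P a S) (hS : Step M P S .retire o S') :
    ∃ a', ArchStep M P a a' ∧ Ahead M P a' S' := by
  obtain ⟨ρ, μ, p₀⟩ := a
  obtain ⟨h1, h2, i₀, e, g, h⟩ := h
  cases hS with
  | value_retire hi hb ht =>
    subst h1 h2 hi
    obtain ⟨hi, -⟩ := h.minIdx_eq' hb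
    simp only [hi] at *
    obtain ⟨p₁, h3, h4⟩ := h.retire_value hP hb ht
    exact ⟨_, h3, rfl, rfl, _, _, _, h4⟩
  | jump_retire hi hb =>
    subst h1 h2 hi
    obtain ⟨hi, -⟩ := h.minIdx_eq' hb
    simp only [hi] at *
    obtain ⟨p₁, h3, h4⟩ := h.retire_jump hP hb
    exact ⟨_, h3, rfl, rfl, _, _, _, h4⟩
  | fence_retire hi hb =>
    subst h1 h2 hi
    obtain ⟨hi, -⟩ := h.minIdx_eq' hb
    simp only [hi] at *
    obtain ⟨p₁, h3, h4⟩ := h.retire_fence hP hb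
    exact ⟨_, h3, rfl, rfl, _, _, _, h4⟩
  | store_retire hi hb =>
    subst h1 h2 hi
    obtain ⟨hi, -⟩ := h.minIdx_eq' hb
    simp only [hi] at *
    obtain ⟨p₁, h3, h4⟩ := h.retire_store hP hb
    exact ⟨_, h3, rfl, rfl, _, _, _, h4⟩
  | call_retire hi hb hb₁ ht₁ hb₂ =>
    subst h1 h2 hi
    obtain ⟨hi, -⟩ := h.minIdx_eq' hb
    simp only [hi] at *
    obtain ⟨p₁, h3, h4⟩ := h.retire_call hP hb hb₁ ht₁ hb₂
    exact ⟨_, h3, rfl, rfl, _, _, _, h4⟩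
  | ret_retire hi hb hb₁ ht₁ hb₂ ht₂ hb₃ =>
    subst h1 h2 hi
    obtain ⟨hi, -⟩ := h.minIdx_eq' hb
    simp only [hi] at *
    obtain ⟨p₁, h3, h4⟩ := h.retire_ret hP hb hb₁ ht₁ hb₂ ht₂ hb₃
    exact ⟨_, h3, rfl, rfl, _, _, _, h4⟩

/-- Fetching and executing touch neither registers nor memory. They only extend, refine or cut back
the predicted path, and the architectural state stays put. -/
theorem Ahead.step {M : Machine V R F B} {P : Program V L R F B}
    {a : (R → Option (V × L)) × (V → Option (V × L)) × V} {S S' : State V L R F B} {d o}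
    (h : Ahead M P a S) (hS : Step M P S d o S') (hd : d ≠ .retire) : Ahead M P a S' := by
  obtain ⟨ρ', μ', p₀⟩ := a
  obtain ⟨h1, h2, i₀, e, g, h⟩ := h
  subst h1 h2
  cases hS with
  | @simple_fetch ρ μ n buf σ I t n' hI ht =>
    obtain ⟨i₁, h'⟩ := h.exists_fresh
    have hT : Tracks M (Speculative.insert buf (fresh buf) t) ρ μ (fresh buf) t t := by
      cases I <;> simp only [Instr.simple, Option.some.injEq, Prod.mk.injEq, reduceCtorEq] at ht <;>
        obtain ⟨rfl, -⟩ := ht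
      · exact .refl trivial
      · exact .refl trivial
      · exact .store (.inl rfl) (.inl rfl)
      · exact .refl trivial
    exact ⟨rfl, rfl, i₁, h'.fetch_one (.simple hI ht (by simp)) hT⟩
  | cond_fetch b hI =>
    obtain ⟨i₁, h'⟩ := h.exists_fresh
    exact ⟨rfl, rfl, i₁, h'.fetch_one (.br hI (by simp)) (.refl trivial)⟩
  | jmpi_fetch n' hI =>
    obtain ⟨i₁, h'⟩ := h.exists_fresh
    exact ⟨rfl, rfl, i₁, h'.fetch_one (.jmpi hI (by simp)) (.refl trivial)⟩
  | call_fetch hI hi =>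
    obtain ⟨i₁, h'⟩ := h.exists_fresh
    exact ⟨rfl, rfl, i₁, h'.fetch_call hI hi⟩
  | ret_fetch_rsb hI htop hi =>
    obtain ⟨i₁, h'⟩ := h.exists_fresh
    exact ⟨rfl, rfl, i₁, h'.fetch_ret hI hi⟩
  | ret_fetch_rsb_empty n' hI htop hi =>
    obtain ⟨i₁, h'⟩ := h.exists_fresh
    exact ⟨rfl, rfl, i₁, h'.fetch_ret hI hi⟩
  | op_execute hb hf hv =>
    exact ⟨rfl, rfl, i₀, e, g, h.insert' hb (h.of_op hb ▸ .op hv) (by simp [Trans.value])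
      (by simp [Trans.StoresTo]) (by simp)⟩
  | cond_execute_correct hb hf hv hn =>
    exact ⟨rfl, rfl, i₀, e, g, h.insert' hb (h.of_br hb ▸ .br hv hn) (by simp [Trans.value])
      (by simp [Trans.StoresTo]) (by simp)⟩
  | cond_execute_incorrect hb hf hv hn hne => exact ⟨rfl, rfl, i₀, _, h.redirect_br hb hv hn⟩
  | jmpi_execute_correct hb hf hv hn =>
    exact ⟨rfl, rfl, i₀, e, g, h.insert' hb (h.of_jmpi hb ▸ .jmpi hv hn) (by simp [Trans.value])
      (by simp [Trans.StoresTo]) (by simp)⟩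
  | jmpi_execute_incorrect hb hf hv hn hne => exact ⟨rfl, rfl, i₀, _, h.redirect_jmpi hb hv hn⟩
  | load_execute_nodep hb hf hv ha hs hm =>
    exact ⟨rfl, rfl, i₀, e, g, h.insert' hb
      (h.of_load hb ▸ .loadVal hv ha (.inr ⟨hm, hs, fun _ _ => WithBot.bot_lt_coe _⟩))
      (by simp [Trans.value]) (by simp [Trans.StoresTo]) (by simp)⟩
  | load_execute_forward hb hf hv ha hj hbj hs =>
    refine ⟨rfl, rfl, i₀, e, g, h.insert' hb
      (h.of_load hb ▸ .loadVal hv ha (.inl ⟨_, _, rfl, hj, hbj, ?_, hs⟩))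
      (by simp [Trans.value]) (by simp [Trans.StoresTo]) (by simp)⟩
    rintro _ _ ⟨⟩
    rfl
  | load_execute_guess hb hf hj hbj =>
    exact ⟨rfl, rfl, i₀, e, g, h.insert' hb (h.of_load hb ▸ .loadFwd hj)
      (by simp [Trans.value]) (by simp [Trans.StoresTo]) (by simp)⟩
  | load_addr_ok hb hf hv ha hbj hsa hs =>
    have ht := h.tracks' hb
    rw [h.of_loadFwd hb] at ht
    -- The inequality `j < i` is not among the conditions of this step; it was recorded when the
    -- value was forwarded.
    cases ht with
    | loadFwd hj =>
      exact ⟨rfl, rfl, i₀, e, g, h.insert' hb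
        (h.of_loadFwd hb ▸ .loadVal hv ha (.inl ⟨_, _, rfl, hj, hbj, hsa, hs⟩))
        (by simp [Trans.value]) (by simp [Trans.StoresTo]) (by simp)⟩
  | load_addr_hazard hb => exact ⟨rfl, rfl, i₀, _, g, h.truncate_loadFwd hb⟩
  | load_mem_match hb hf hv ha hbj hs hm =>
    exact ⟨rfl, rfl, i₀, e, g, h.insert' hb
      (h.of_loadFwd hb ▸ .loadVal hv ha (.inr ⟨hm, hs, fun _ _ => WithBot.bot_lt_coe _⟩))
      (by simp [Trans.value]) (by simp [Trans.StoresTo]) (by simp)⟩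
  | load_mem_hazard hb => exact ⟨rfl, rfl, i₀, _, g, h.truncate_loadFwd hb⟩
  | @store_execute_value ρ μ n buf σ i src sa v hb hf hv =>
    refine ⟨rfl, rfl, i₀, e, g, h.insert' hb ?_ (by simp [Trans.value])
      (by simp [Trans.StoresTo]) ?_⟩
    · have ht := h.tracks' hb
      generalize g i = t at ht
      cases ht with
      | refl h => exact h.elim
      | store hs hv' =>
        refine .store (.inr ⟨v, rfl, ?_⟩) hv'
        rcases hs with rfl | ⟨w, rfl, hs⟩
        · exact hv
        · cases hv; exact hs
    · rintro w sa' ⟨⟩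
      cases hv
      rfl
  | store_addr_ok hb hf hv ha hk => exact ⟨rfl, rfl, i₀, e, g, h.resolve_addr hb hv ha hk⟩
  | @store_addr_hazard ρ μ n buf σ i src args vs a k t pc hb hf hv ha hik hbk ht hmin =>
    -- The rollback is split in two: the buffer is cut at the least conflicting load, and by
    -- minimality the address then resolves without any hazard in what is left.
    refine ⟨rfl, rfl, i₀, k, g, (h.truncate_hazard hbk ht).resolve_addr
      (args := args) (by simp [before, hik, hb]) ?_ ha fun k' t' pc' h1 h2 => ?_⟩
    · rw [resolveAll_congr (buf := buf) fun j hj => by simp [before, hj.trans hik], hv]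
    · simp only [before] at h2
      split_ifs at h2 with hk'
      exact hmin k' t' pc' h1 hk' h2
  | _ => exact absurd rfl hd

theorem Ahead.steps {M : Machine V R F B} {P : Program V L R F B}
    (hP : ∀ n I, P n = some I → Operand.reg M.rret ∉ I.operands)
    {S S' : State V L R F B} {D O} (hS : Steps (Step M P) S D O S')
    {a : (R → Option (V × L)) × (V → Option (V × L)) × V} (h : Ahead M P a S) :
    ∃ a', ArchRun M P (numRetired D) a a' ∧ Ahead M P a' S' := by
  induction hS generalizing a with
  | nil S => exact ⟨a, .zero a, h⟩
  | @cons S S' S'' d o D O hd _ ih =>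
    by_cases hr : d = .retire
    · subst hr
      obtain ⟨b, h1, h2⟩ := h.retire hP hd
      obtain ⟨c, h3, h4⟩ := ih h2
      exact ⟨c, .succ h1 h3, h4⟩
    · obtain ⟨c, h3, h4⟩ := ih (h.step hd hr)
      refine ⟨c, ?_, h4⟩
      cases d <;> first | exact h3 | exact absurd rfl hr

theorem Steps.mono {T T' : State V L R F B → Directive V → List (Obs V L) → State V L R F B → Prop}
    (hT : ∀ S d o S', T S d o S' → T' S d o S') {S D O S'} (h : Steps T S D O S') :
    Steps T' S D O S' := by
  induction h with
  | nil S => exact .nil S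
  | cons h _ ih => exact .cons (hT _ _ _ _ h) ih

/-- Dropping the restriction on fetches turns a sequential execution into a speculative one, to
which the same simulation applies. Its terminal end makes the final program point architectural. -/
theorem SeqBigStep.archRun {M : Machine V R F B} {P : Program V L R F B}
    (hP : ∀ n I, P n = some I → Operand.reg M.rret ∉ I.operands) {N : ℕ}
    {C C' : Config V L R F B} {σ σ' O} (h : SeqBigStep M P N ⟨C, σ⟩ O ⟨C', σ'⟩) :
    ArchRun M P N (C.reg, C.mem, C.pc) (C'.reg, C'.mem, C'.pc) := by
  obtain ⟨h1, h2, D, h3, rfl⟩ := h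
  obtain ⟨⟨ρ, μ, p⟩, h4, h5, h6, i₀, e, g, h7⟩ :=
    Ahead.steps hP (h3.mono fun _ _ _ _ h => h.1) (Ahead.of_terminal h1 σ)
  have := h7.of_terminal h2
  simp only at h5 h6 this
  rw [h5, h6, this]
  exact h4

end Simulation

/-! ### Sequential executions that realise in-order runs. -/

section Existence

variable {V L R F B : Type*} [DecidableEq V] [DecidableEq R] [Lattice L] [OrderBot L]

theorem Steps.append {T : State V L R F B → Directive V → List (Obs V L) → State V L R F B → Prop}
    {S S' S'' D D' O O'} (h : Steps T S D O S') (h' : Steps T S' D' O' S'') :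
    Steps T S (D ++ D') (O ++ O') S'' := by
  induction h with
  | nil S => exact h'
  | cons h _ ih =>
    rw [List.append_assoc]
    exact .cons h (ih h')

theorem numRetired_append (D D' : List (Directive V)) :
    numRetired (D ++ D') = numRetired D + numRetired D' := by
  induction D with
  | nil => simp [numRetired]
  | cons d D ih =>
    cases d <;> simp only [List.cons_append, numRetired, ih]
    omega

/-- The supremum of the empty set of naturals is `0`, so an empty buffer is filled from index `1`
on. This is why `ofList` leaves index `0` vacant. -/
theorem fresh_none {α : Type*} : fresh (fun _ => none : ℕ → Option α) = 1 := by
  simp [fresh, maxIdx]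

theorem minIdx_eq_one {α : Type*} {m : ℕ → Option α} (h0 : m 0 = none) (h1 : m 1 ≠ none) :
    minIdx m = 1 :=
  IsLeast.csInf_eq ⟨h1, fun j hj => Nat.one_le_iff_ne_zero.mpr (by rintro rfl; exact hj h0)⟩

/-- A step of a sequential execution that does not fetch. -/
theorem SeqStep.of_step {M : Machine V R F B} {P : Program V L R F B} {S S' : State V L R F B}
    {d o} (h : Step M P S d o S') (hd : ¬ d.IsFetch) : SeqStep M P S d o S' :=
  ⟨h, fun h => absurd h hd⟩

/-- The buffer with the given entries at the indices `1, 2, …`. -/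
def ofList {α : Type*} (l : List α) : ℕ → Option α
  | 0 => none
  | i + 1 => l[i]?

theorem insert_fresh_none {α : Type*} (t : α) :
    insert (fun _ => none) (fresh (fun _ => none : ℕ → Option α)) t = ofList [t] := by
  rw [fresh_none]
  funext i
  rcases i with _ | _ | i <;> simp [ofList, insert]

theorem insert_ofList {α : Type*} (l : List α) (i : ℕ) (t : α) (hi : i < l.length) :
    insert (ofList l) (i + 1) t = ofList (l.set i t) := by
  funext j
  rcases j with _ | j
  · simp [ofList, insert]
  · by_cases h : j = i
    · subst h
      simp [ofList, insert, hi]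
    · simp [ofList, insert, h, Ne.symm h]

theorem erase_ofList_singleton {α : Type*} (t : α) : erase (ofList [t]) 1 = fun _ => none := by
  funext i
  rcases i with _ | _ | i <;> simp [ofList, erase]

theorem after_ofList {α : Type*} (l : List α) {k : ℕ} (hk : l.length ≤ k) :
    after (ofList l) k = fun _ => none := by
  funext i
  rcases i with _ | i
  · simp [after]
  · simp only [after, ofList, ite_eq_right_iff]
    intro h
    simp only [List.getElem?_eq_none_iff]
    omega

theorem minIdx_ofList {α : Type*} (t : α) (l : List α) : minIdx (ofList (t :: l)) = 1 :=
  minIdx_eq_one rfl (by simp [ofList])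

section Single

variable {M : Machine V R F B} {P : Program V L R F B} {ρ : R → Option (V × L)}
  {μ : V → Option (V × L)} {n : V} {σ : Rsb V} {t : Trans V L R F B}

theorem SeqStep.fetch_of {d n'} (hd : Step M P ⟨⟨ρ, μ, n, fun _ => none⟩, σ⟩ d []
      ⟨⟨ρ, μ, n', insert (fun _ => none) (fresh (fun _ => none : Buf V L R F B)) t⟩, σ⟩) :
    SeqStep M P ⟨⟨ρ, μ, n, fun _ => none⟩, σ⟩ d [] ⟨⟨ρ, μ, n', ofList [t]⟩, σ⟩ :=
  ⟨by rwa [insert_fresh_none] at hd, fun _ _ => rfl⟩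

theorem SeqStep.execute_of {d o u} (hd : Step M P ⟨⟨ρ, μ, n, ofList [t]⟩, σ⟩ d o
      ⟨⟨ρ, μ, n, insert (ofList [t]) 1 u⟩, σ⟩) (hf : ¬ d.IsFetch) :
    SeqStep M P ⟨⟨ρ, μ, n, ofList [t]⟩, σ⟩ d o ⟨⟨ρ, μ, n, ofList [u]⟩, σ⟩ :=
  .of_step (by rwa [insert_ofList [t] 0 u (by simp)] at hd) hf

theorem SeqStep.retire_of {ρ' μ' o} (hd : Step M P ⟨⟨ρ, μ, n, ofList [t]⟩, σ⟩ .retire o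
      ⟨⟨ρ', μ', n, erase (ofList [t]) 1⟩, σ⟩) :
    SeqStep M P ⟨⟨ρ, μ, n, ofList [t]⟩, σ⟩ .retire o ⟨⟨ρ', μ', n, fun _ => none⟩, σ⟩ :=
  .of_step (by rwa [erase_ofList_singleton] at hd) id

theorem ofList_eq_none {α : Type*} (l : List α) : ∀ j < 1, ofList l j = none := by
  intro j hj
  obtain rfl : j = 0 := by omega
  rfl

theorem noFence_ofList (l : List (Trans V L R F B)) : NoFence (ofList l) 1 := fun j hj => by
  simp [ofList_eq_none l j hj]

theorem noStore_ofList (l : List (Trans V L R F B)) (a : V) : NoStore (ofList l) a 0 1 :=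
  fun j t _ hj ht => by simp [ofList_eq_none l j hj] at ht

end Single

theorem ArchStep.exists_seq_call {M : Machine V R F B} {P : Program V L R F B}
    {ρ : R → Option (V × L)} {μ : V → Option (V × L)} {p nf nr v}
    (hI : P p = some (.call nf nr)) (hr : ρ M.rsp = some v) (σ : Rsb V) :
    ∃ σ' D O, Steps (SeqStep M P) ⟨⟨ρ, μ, p, fun _ => none⟩, σ⟩ D O
      ⟨⟨Function.update ρ M.rsp (some (M.evalOp M.succ (vals [v]), lub [v])),
        Function.update μ (M.addr [M.evalOp M.succ (vals [v])]) (some (nr, ⊥)), nf,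
        fun _ => none⟩, σ'⟩ ∧ numRetired D = 1 := by
  set w := (M.evalOp M.succ (vals [v]), lub [v]) with hw
  set t₁ : Trans V L R F B := .op M.succ M.rsp [.reg M.rsp]
  set t₂ : Trans V L R F B := .store (.val (nr, ⊥)) (.pending [.reg M.rsp])
  have h1 : SeqStep M P ⟨⟨ρ, μ, p, fun _ => none⟩, σ⟩ .fetch []
      ⟨⟨ρ, μ, nf, ofList [.call, t₁, t₂]⟩, insert σ 1 (.push nr)⟩ := by
    refine ⟨?_, fun _ _ => rfl⟩
    convert Step.call_fetch (M := M) (μ := μ) (ρ := ρ) (σ := σ) hI fresh_none.symm using 3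
    funext i
    rcases i with _ | _ | _ | _ | i <;> simp [ofList, insert, t₁, t₂]
  have h2 : SeqStep M P ⟨⟨ρ, μ, nf, ofList [.call, t₁, t₂]⟩, insert σ 1 (.push nr)⟩
      (.execute 2) [] ⟨⟨ρ, μ, nf, ofList [.call, .val M.rsp w, t₂]⟩, insert σ 1 (.push nr)⟩ := by
    refine .of_step ?_ id
    have := Step.op_execute (M := M) (P := P) (μ := μ) (ρ := ρ) (n := nf)
      (σ := insert σ 1 (.push nr)) (buf := ofList [.call, t₁, t₂]) (i := 2) rfl
      (by intro j hj; interval_cases j <;> simp [ofList]) (vs := [v])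
      (by simp [resolveAll, resolve, resolveReg, ofList, Trans.dest, hr])
    rwa [insert_ofList _ 1 _ (by simp)] at this
  -- Only the address has to be executed, since the value stored by a call is a constant.
  have h3 : SeqStep M P ⟨⟨ρ, μ, nf, ofList [.call, .val M.rsp w, t₂]⟩, insert σ 1 (.push nr)⟩
      (.executeAddr 3) [.fwd (M.addr (vals [w]), lub [w])]
      ⟨⟨ρ, μ, nf, ofList [.call, .val M.rsp w,
        .store (.val (nr, ⊥)) (.resolved (M.addr (vals [w]), lub [w]))]⟩,
        insert σ 1 (.push nr)⟩ := by
    refine .of_step ?_ id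
    have := Step.store_addr_ok (M := M) (P := P) (μ := μ) (ρ := ρ) (n := nf)
      (σ := insert σ 1 (.push nr)) (buf := ofList [.call, .val M.rsp w, t₂]) (i := 3) rfl
      (by intro j hj; interval_cases j <;> simp [ofList]) (vs := [w])
      (by simp [resolveAll, resolve, resolveReg, ofList, Trans.dest, Trans.value]) rfl
      (by
        intro k t pc hk hb
        obtain ⟨k, rfl⟩ := Nat.exists_eq_add_of_lt hk
        rw [show 3 + k + 1 = (k + 3) + 1 by omega] at hb
        simp [ofList] at hb)
    rwa [insert_ofList _ 2 _ (by simp)] at this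
  have h4 := Step.call_retire (M := M) (P := P) (μ := μ) (ρ := ρ) (n := nf)
    (σ := insert σ 1 (.push nr)) (buf := ofList [.call, .val M.rsp w,
        .store (.val (nr, ⊥)) (.resolved (M.addr (vals [w]), lub [w]))])
    (minIdx_ofList _ _) rfl rfl .val rfl
  rw [after_ofList _ (by simp)] at h4
  exact ⟨_, _, _, .cons h1 (.cons h2 (.cons h3 (.cons (.of_step h4 id) (.nil _)))), rfl⟩

/-- The guess cannot be chosen freely here: an arbitrary `σ` may dictate a wrong target. A
misprediction does no harm, because the jump is the last entry and the rollback removes nothing else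
from the buffer. -/
theorem ArchStep.exists_seq_ret {M : Machine V R F B} {P : Program V L R F B}
    {ρ : R → Option (V × L)} {μ : V → Option (V × L)} {p v w}
    (hI : P p = some .ret) (hr : ρ M.rsp = some v) (hm : μ (M.addr (vals [v])) = some w)
    (σ : Rsb V) :
    ∃ σ' D O, Steps (SeqStep M P) ⟨⟨ρ, μ, p, fun _ => none⟩, σ⟩ D O
      ⟨⟨Function.update ρ M.rsp (some (M.evalOp M.pred (vals [v]), lub [v])), μ,
        M.addr (vals [w]), fun _ => none⟩, σ'⟩ ∧ numRetired D = 1 := by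
  set v' := (M.evalOp M.pred (vals [v]), lub [v]) with hv'
  set t₁ : Trans V L R F B := .load M.rret [.reg M.rsp] p
  set t₂ : Trans V L R F B := .op M.pred M.rsp [.reg M.rsp]
  set u₁ : Trans V L R F B := .loadVal M.rret w ⊥ (M.addr (vals [v])) p
  have hne := M.rsp_ne_rret
  have hent : ∀ n', retEntries M (fun _ => none : Buf V L R F B) 1 p n' =
      ofList [.ret, t₁, t₂, .jmpi [.reg M.rret] n'] := fun n' => by
    funext i
    rcases i with _ | _ | _ | _ | _ | i <;> simp [retEntries, ofList, insert, t₁, t₂]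
  obtain ⟨n', d, h1, hd⟩ : ∃ n' d, SeqStep M P ⟨⟨ρ, μ, p, fun _ => none⟩, σ⟩ d []
      ⟨⟨ρ, μ, n', ofList [.ret, t₁, t₂, .jmpi [.reg M.rret] n']⟩, insert σ 1 .pop⟩ ∧
      numRetired [d] = 0 := by
    cases htop : Rsb.top σ with
    | none =>
      -- Any guess would do, since both outcomes of the jump are treated below.
      refine ⟨p, .fetchTarget p, ⟨?_, fun _ _ => rfl⟩, rfl⟩
      rw [← hent]
      exact .ret_fetch_rsb_empty p hI htop fresh_none.symm
    | some n' =>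
      refine ⟨n', .fetch, ⟨?_, fun _ _ => rfl⟩, rfl⟩
      rw [← hent]
      exact .ret_fetch_rsb hI htop fresh_none.symm
  have h2 : SeqStep M P
      ⟨⟨ρ, μ, n', ofList [.ret, t₁, t₂, .jmpi [.reg M.rret] n']⟩, insert σ 1 .pop⟩
      (.execute 2) [.read (M.addr (vals [v]), lub [v])]
      ⟨⟨ρ, μ, n', ofList [.ret, u₁, t₂, .jmpi [.reg M.rret] n']⟩, insert σ 1 .pop⟩ := by
    refine .of_step ?_ id
    have := Step.load_execute_nodep (M := M) (P := P) (μ := μ) (ρ := ρ) (n := n')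
      (σ := insert σ 1 .pop) (buf := ofList [.ret, t₁, t₂, .jmpi [.reg M.rret] n']) (i := 2) rfl
      (by intro j hj; interval_cases j <;> simp [ofList]) (vs := [v])
      (by simp [resolveAll, resolve, resolveReg, ofList, Trans.dest, hr]) rfl
      (by
        rintro j t - hj ht ⟨src, l, rfl⟩
        interval_cases j <;> simp [ofList] at ht) hm
    rwa [insert_ofList _ 1 _ (by simp)] at this
  have h3 : SeqStep M P
      ⟨⟨ρ, μ, n', ofList [.ret, u₁, t₂, .jmpi [.reg M.rret] n']⟩, insert σ 1 .pop⟩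
      (.execute 3) []
      ⟨⟨ρ, μ, n', ofList [.ret, u₁, .val M.rsp v', .jmpi [.reg M.rret] n']⟩,
        insert σ 1 .pop⟩ := by
    refine .of_step ?_ id
    have := Step.op_execute (M := M) (P := P) (μ := μ) (ρ := ρ) (n := n')
      (σ := insert σ 1 .pop) (buf := ofList [.ret, u₁, t₂, .jmpi [.reg M.rret] n']) (i := 3) rfl
      (by intro j hj; interval_cases j <;> simp [ofList, u₁]) (vs := [v])
      (by simp [resolveAll, resolve, resolveReg, ofList, Trans.dest, hr, u₁, hne.symm])
    rwa [insert_ofList _ 2 _ (by simp)] at this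
  obtain ⟨o, σ', h4⟩ : ∃ o σ', SeqStep M P
      ⟨⟨ρ, μ, n', ofList [.ret, u₁, .val M.rsp v', .jmpi [.reg M.rret] n']⟩, insert σ 1 .pop⟩
      (.execute 4) o
      ⟨⟨ρ, μ, M.addr (vals [w]), ofList [.ret, u₁, .val M.rsp v', .jump (M.addr (vals [w]))]⟩,
        σ'⟩ := by
    have hf : NoFence (ofList [.ret, u₁, .val M.rsp v', .jmpi [.reg M.rret] n']) 4 := by
      intro j hj
      interval_cases j <;> simp [ofList, u₁]
    have hv : resolveAll (ofList [.ret, u₁, .val M.rsp v', .jmpi [.reg M.rret] n']) ρ 4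
        [.reg M.rret] = some [w] := by
      simp [resolveAll, resolve, resolveReg, ofList, Trans.dest, Trans.value, u₁, hne]
    by_cases hn : M.addr (vals [w]) = n'
    · subst hn
      refine ⟨[.jump (M.addr (vals [w]), lub [w])], insert σ 1 .pop, .of_step ?_ id⟩
      · have := Step.jmpi_execute_correct (M := M) (P := P) (μ := μ) (ρ := ρ)
          (n := M.addr (vals [w])) (σ := insert σ 1 .pop) rfl hf hv rfl
        rwa [insert_ofList _ 3 _ (by simp)] at this
    · refine ⟨[.rollback, .jump (M.addr (vals [w]), lub [w])], before (insert σ 1 .pop) 4,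
        .of_step ?_ id⟩
      · convert Step.jmpi_execute_incorrect (M := M) (P := P) (μ := μ) (ρ := ρ)
          (n := n') (σ := insert σ 1 .pop) rfl hf hv rfl hn using 3
        funext i
        rcases i with _ | _ | _ | _ | _ | i <;> simp [ofList, insert, before]
  have h5 := Step.ret_retire (M := M) (P := P) (μ := μ) (ρ := ρ) (n := M.addr (vals [w]))
    (σ := σ') (buf := ofList [.ret, u₁, .val M.rsp v', .jump (M.addr (vals [w]))])
    (minIdx_ofList _ _) rfl rfl (.loadVal _ _ _) rfl .val rfl
  rw [after_ofList _ (by simp)] at h5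
  refine ⟨_, _, _, .cons h1 (.cons h2 (.cons h3 (.cons h4 (.cons (.of_step h5 id) (.nil _))))), ?_⟩
  cases d <;> first | rfl | cases hd

/-- A sequential execution of a single instruction realises a step of the architectural
semantics. -/
theorem ArchStep.exists_seq {M : Machine V R F B} {P : Program V L R F B} {a b}
    (h : ArchStep M P a b) (σ : Rsb V) :
    ∃ σ' D O, Steps (SeqStep M P) ⟨⟨a.1, a.2.1, a.2.2, fun _ => none⟩, σ⟩ D O
      ⟨⟨b.1, b.2.1, b.2.2, fun _ => none⟩, σ'⟩ ∧ numRetired D = 1 := by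
  have hall : ∀ (ρ : R → Option (V × L)) (t : Trans V L R F B) (args : List (Operand V L R)),
      resolveAll (ofList [t]) ρ 1 args =
        resolveAll (fun _ => none : Buf V L R F B) ρ 0 args := fun ρ t args =>
    resolveAll_of_none (ofList_eq_none _) args
  cases h with
  | @op ρ μ p f r args next vs hI hv =>
    have h1 := SeqStep.fetch_of (Step.simple_fetch (M := M) (μ := μ) (ρ := ρ) (σ := σ) hI rfl)
    have h2 := SeqStep.execute_of (Step.op_execute (M := M) (P := P) (μ := μ) (n := next) (σ := σ)
      (buf := ofList [.op f r args]) rfl (noFence_ofList _) ((hall _ _ _).trans hv)) id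
    have h3 := SeqStep.retire_of (Step.value_retire (M := M) (P := P) (ρ := ρ) (μ := μ) (n := next)
      (σ := σ) (buf := ofList [.val r (M.evalOp f (vals vs), lub vs)]) (minIdx_ofList _ _) rfl .val)
    exact ⟨_, _, _, .cons h1 (.cons h2 (.cons h3 (.nil _))), rfl⟩
  | @br ρ μ p f args nt nf vs hI hv =>
    -- The directive supplies the correct outcome, so no rollback occurs.
    have h1 := SeqStep.fetch_of (Step.cond_fetch (M := M) (μ := μ) (ρ := ρ) (σ := σ)
      (M.evalCond f (vals vs)) hI)
    have h2 := SeqStep.execute_of (Step.cond_execute_correct (M := M) (P := P) (μ := μ)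
      (n := cond (M.evalCond f (vals vs)) nt nf) (σ := σ)
      (buf := ofList [.br f args (cond (M.evalCond f (vals vs)) nt nf) nt nf]) rfl (noFence_ofList _) ((hall _ _ _).trans hv) rfl) id
    have h3 := SeqStep.retire_of (Step.jump_retire (M := M) (P := P) (ρ := ρ) (μ := μ)
      (n := cond (M.evalCond f (vals vs)) nt nf) (σ := σ)
      (buf := ofList [.jump (cond (M.evalCond f (vals vs)) nt nf)]) (minIdx_ofList _ _) rfl)
    exact ⟨_, _, _, .cons h1 (.cons h2 (.cons h3 (.nil _))), rfl⟩
  | @load ρ μ p r args next vs v hI hv hm =>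
    have h1 := SeqStep.fetch_of (Step.simple_fetch (M := M) (μ := μ) (ρ := ρ) (σ := σ) hI rfl)
    have h2 := SeqStep.execute_of (Step.load_execute_nodep (M := M) (P := P) (μ := μ) (n := next)
      (σ := σ) (buf := ofList [.load r args p]) rfl (noFence_ofList _) ((hall _ _ _).trans hv) rfl
      (noStore_ofList _ _) hm) id
    have h3 := SeqStep.retire_of (Step.value_retire (M := M) (P := P) (ρ := ρ) (μ := μ) (n := next)
      (σ := σ) (buf := ofList [.loadVal r v ⊥ (M.addr (vals vs)) p]) (minIdx_ofList _ _) rfl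
      (.loadVal _ _ _))
    exact ⟨_, _, _, .cons h1 (.cons h2 (.cons h3 (.nil _))), rfl⟩
  | @store ρ μ p src args next vs v hI hs hv =>
    have h1 := SeqStep.fetch_of (Step.simple_fetch (M := M) (μ := μ) (ρ := ρ) (σ := σ) hI rfl)
    have h2 := SeqStep.execute_of (Step.store_execute_value (M := M) (P := P) (μ := μ) (n := next)
      (σ := σ) (buf := ofList [.store src (.pending args)]) rfl (noFence_ofList _)
      (by rw [resolve_of_none (ofList_eq_none _), hs])) id
    have h3 := SeqStep.execute_of (Step.store_addr_ok (M := M) (P := P) (μ := μ) (n := next)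
      (σ := σ) (buf := ofList [.store (.val v) (.pending args)]) rfl (noFence_ofList _)
      ((hall _ _ _).trans hv) rfl (by
        intro k t pc hk hb
        obtain ⟨k, rfl⟩ := Nat.exists_eq_add_of_lt hk
        rw [show 1 + k + 1 = (k + 1) + 1 by omega] at hb
        simp [ofList] at hb)) id
    have h4 := SeqStep.retire_of (Step.store_retire (M := M) (P := P) (ρ := ρ) (μ := μ) (n := next)
      (σ := σ) (buf := ofList [.store (.val v) (.resolved (M.addr (vals vs), lub vs))])
      (minIdx_ofList _ _) rfl)
    exact ⟨_, _, _, .cons h1 (.cons h2 (.cons h3 (.cons h4 (.nil _)))), rfl⟩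
  | @jmpi ρ μ p args vs hI hv =>
    have h1 := SeqStep.fetch_of (Step.jmpi_fetch (M := M) (μ := μ) (ρ := ρ) (σ := σ)
      (M.addr (vals vs)) hI)
    have h2 := SeqStep.execute_of (Step.jmpi_execute_correct (M := M) (P := P) (μ := μ)
      (n := M.addr (vals vs)) (σ := σ) (buf := ofList [.jmpi args (M.addr (vals vs))]) rfl
      (noFence_ofList _) ((hall _ _ _).trans hv) rfl) id
    have h3 := SeqStep.retire_of (Step.jump_retire (M := M) (P := P) (ρ := ρ) (μ := μ)
      (n := M.addr (vals vs)) (σ := σ) (buf := ofList [.jump (M.addr (vals vs))])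
      (minIdx_ofList _ _) rfl)
    exact ⟨_, _, _, .cons h1 (.cons h2 (.cons h3 (.nil _))), rfl⟩
  | call hI hr => exact ArchStep.exists_seq_call hI hr σ
  | ret hI hr hm => exact ArchStep.exists_seq_ret hI hr hm σ
  | @fence ρ μ p next hI =>
    have h1 := SeqStep.fetch_of (Step.simple_fetch (M := M) (μ := μ) (ρ := ρ) (σ := σ) hI rfl)
    have h3 := SeqStep.retire_of (Step.fence_retire (M := M) (P := P) (ρ := ρ) (μ := μ) (n := next)
      (σ := σ) (buf := ofList [.fence]) (minIdx_ofList _ _) rfl)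
    exact ⟨_, _, _, .cons h1 (.cons h3 (.nil _)), rfl⟩

theorem ArchRun.exists_seq {M : Machine V R F B} {P : Program V L R F B} {N : ℕ} {a b}
    (h : ArchRun M P N a b) (σ : Rsb V) :
    ∃ σ' D O, Steps (SeqStep M P) ⟨⟨a.1, a.2.1, a.2.2, fun _ => none⟩, σ⟩ D O
      ⟨⟨b.1, b.2.1, b.2.2, fun _ => none⟩, σ'⟩ ∧ numRetired D = N := by
  induction h generalizing σ with
  | zero a => exact ⟨σ, [], [], .nil _, rfl⟩
  | succ h _ ih =>
    obtain ⟨σ₁, D₁, O₁, h1, h2⟩ := h.exists_seq σ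
    obtain ⟨σ₂, D₂, O₂, h3, h4⟩ := ih σ₁
    exact ⟨σ₂, _, _, h1.append h3, by rw [numRetired_append, h2, h4, add_comm]⟩

end Existence

end Speculative

/-! ### Equivalence of speculative and sequential execution. -/

open Speculative in
theorem theorem1 {V L R F B : Type*} [DecidableEq V] [DecidableEq R] [Lattice L] [OrderBot L]
    [Finite R]
    (M : Machine V R F B) (P : Program V L R F B)
    (hP : ∀ n I, P n = some I → Operand.reg M.rret ∉ I.operands)
    (N : ℕ) (C C₁ : Config V L R F B) (σ σ₁ : Rsb V)
    (D : List (Directive V)) (O₁ : List (Obs V L))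
    (hC : C.Terminal) (hD : BigStep M P N ⟨C, σ⟩ D O₁ ⟨C₁, σ₁⟩) :
    (∃ C₂ σ₂ O₂, SeqBigStep M P N ⟨C, σ⟩ O₂ ⟨C₂, σ₂⟩) ∧
    ∀ C₂ σ₂ O₂, SeqBigStep M P N ⟨C, σ⟩ O₂ ⟨C₂, σ₂⟩ →
      C₁.Equiv C₂ ∧ (C₁.Terminal → C₁ = C₂) := by
  obtain ⟨hD, rfl⟩ := hD
  obtain ⟨⟨ρ, μ, p⟩, hrun, hρ, hμ, i₀, e, g, hinv⟩ := Ahead.steps hP hD (Ahead.of_terminal hC σ)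
  constructor
  · obtain ⟨σ₂, D₂, O₂, h1, h2⟩ := hrun.exists_seq σ
    obtain ⟨ρ₀, μ₀, p₀, buf⟩ := C
    obtain rfl : buf = fun _ => none := funext hC
    exact ⟨_, σ₂, O₂, hC, fun _ => rfl, D₂, h1, h2⟩
  · intro C₂ σ₂ O₂ hseq
    -- Both executions give in-order runs of the same length from the same state, so the runs end in
    -- the same state.
    have heq := hrun.deterministic (hseq.archRun hP)
    simp only [Prod.mk.injEq] at heq hρ hμ
    obtain ⟨h1, h2, h3⟩ := heq
    refine ⟨⟨hρ.trans h1, hμ.trans h2⟩, fun hT => ?_⟩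
    have hp := hinv.of_terminal hT
    obtain ⟨ρ₁, μ₁, p₁, buf₁⟩ := C₁
    obtain ⟨ρ₂, μ₂, p₂, buf₂⟩ := C₂
    simp only [Config.mk.injEq]
    exact ⟨hρ.trans h1, hμ.trans h2, hp.trans h3, funext fun i => (hT i).trans (hseq.2.1 i).symm⟩
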